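/- **Model.** The network is an $n$-vertex undirected graph $G=(V,E)$ whose vertices have distinct identity numbers from $\{1,\dots,n\}$. Initially a vertex knows only its identity number and the global parameters $n$ and $a$. Computation is deterministic and proceeds in synchronous rounds; in each round every vertex may send a message of arbitrary size to each neighbor. The running time is the number of rounds. The arboricity of $G$ is the least number of edge-disjoint forests that cover $E$. Logarithms are to base $2$. **Procedure Legal-Coloring$(G,p)$**, with a bound $a$ on the arboricity of $G$ and a fixed constant $0<\varepsilon<1$. Start with the single subgraph $G$ and $\alpha:=a$. While $\alpha>p$: in parallel, split each current subgraph $G'$ into the $p$ subgraphs induced by the color classes of Arbdefective-Coloring$(G')$ with parameters $k=t=p$, and set $\alpha:=\lfloor \alpha/p+(2+\varepsilon)\alpha/p\rfloor$. When the loop ends, color every current subgraph legally with its own palette of $\lfloor(2+\varepsilon)\alpha\rfloor+1$ colors, the palettes being disjoint. Here Arbdefective-Coloring$(G')$ (1) computes an $H$-partition of $V(G')$ into $O(\log n)$ sets $H_1,H_2,\dots$ such that each vertex of $H_i$ has at most $\lfloor(2+\varepsilon)\alpha\rfloor$ neighbors in $\bigcup_{j\ge i}H_j$; (2) computes a coloring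 of each $G'(H_i)$ with $O(t^2)$ colors in which every vertex has at most $\lfloor\alpha/t\rfloor$ neighbors of its own color; (3) orients edges between different $H$-sets towards the greater index, and edges inside an $H$-set with differently colored endpoints towards the greater color, leaving the other edges unoriented; (4) lets each vertex choose one of $k$ colors that is used by the fewest of its parents (the neighbors reached by its outgoing edges). The constants in $O(\log n)$ and $O(t^2)$ depend only on $\varepsilon$. **Statement.** There is a universal integer constant $c$ such that the following holds for every $0<\varepsilon<1$, with suitable constants (depending only on $\varepsilon$) in steps (1) and (2). Let $\eta>0$ be a constant and put $p=2^{c\lceil 1/\eta\rceil}$, so that $p=2^{O(1/\eta)}$ as $\eta\to0$. Then there is a constant $K=K(\varepsilon,\eta)>0$ such that: 1. for every integer $a\ge 2$ and every finite graph $G$ of arboricity at most $a$, every execution of Legal-Coloring$(G,p)$ produces a legal coloring of $G$ with a palette of at most $K a^{1+\eta}$ colors; 2. there is a deterministic distributed algorithm that, for all $n\ge2$, $a\ge2$ and every $n$-vertex graph of arboricity at most $a$, carries out an execution of Legal-Coloring$(G,p)$ (so that every vertex learns its results in all steps and its final color) within $K\log a\log n$ rounds; 3. for every graph $G$ of maximum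 degree $\Delta\ge 2$, the same algorithm run with $a:=\Delta$ carries out an execution of Legal-Coloring$(G,p)$, and produces a legal coloring with at most $K\Delta^{1+\eta}$ colors, within $K\log\Delta\log n$ rounds; 4. if $\eta<1$, there is $\Delta_0$ such that, on all graphs of maximum degree $\Delta\ge\Delta_0$, the algorithm run with $a:=\Delta$ produces a legal coloring with fewer than $\Delta^2$ colors, within $K(\log n)^2$ rounds. -/

import Mathlib

namespace ArbColor

/-! ### Graph notions -/

/-- The edges of `G` are partitioned into `k` edge-disjoint forests. -/
def HasForestDecomposition {V : Type*} (G : SimpleGraph V) (k : ℕ) : Prop :=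
  ∃ F : Fin k → SimpleGraph V,
    (∀ i, (F i).IsAcyclic) ∧ (∀ i j, i ≠ j → Disjoint (F i) (F j)) ∧ (⨆ i, F i) = G

/-- The arboricity: the least number of edge-disjoint forests that cover the edge set.
On a finite vertex set such a number exists. -/
noncomputable def arboricity {V : Type*} (G : SimpleGraph V) : ℕ :=
  sInf {k | HasForestDecomposition G k}

/-- `φ` is a legal coloring of `G` with the `M` colors `0, …, M - 1`. -/
def IsLegalColoring {V : Type*} (G : SimpleGraph V) (M : ℕ) (φ : V → ℕ) : Prop :=
  (∀ v, φ v < M) ∧ ∀ u v, G.Adj u v → φ u ≠ φ v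

/-- The disjoint union of the subgraphs of `G` induced by the classes `{v | z v = i}`. Running a
procedure on this graph is the same as running it in parallel on all these induced subgraphs. -/
def classGraph {V : Type*} (G : SimpleGraph V) (z : V → ℕ) : SimpleGraph V where
  Adj u v := G.Adj u v ∧ z u = z v
  symm := ⟨fun _ _ h => ⟨h.1.symm, h.2.symm⟩⟩
  loopless := ⟨fun _ h => h.1.ne rfl⟩

/-! ### Synchronous deterministic message passing -/

/-- A deterministic algorithm in the synchronous message passing model. A vertex starts with its own
identity number and the two global parameters: the number `n` of vertices and the bound `a`.
In a round, every vertex sends a message to all its neighbors (messages are unrestricted, hence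
what is meant for one neighbor only can be addressed to it inside the message), and then computes
its new state from its old state and the messages it received. After `rounds n a` rounds all
vertices stop, and each one returns an output that is computed from its state. -/
structure LocalAlgorithm (Out : Type) where
  State : Type
  Msg : Type
  /-- initial state from `n`, `a` and the vertex's own identity number -/
  init : ℕ → ℕ → ℕ → State
  send : State → Msg
  recv : State → Multiset Msg → State
  rounds : ℕ → ℕ → ℕ
  out : State → Out

namespace LocalAlgorithm

variable {Out : Type} {V : Type*} [Fintype V]

open Classical in
/-- The state of vertex `v` after `t` rounds on the network `G` with identity numbers `ident`. -/
noncomputable def stateAt (A : LocalAlgorithm Out) (G : SimpleGraph V) (ident : V → ℕ) (a : ℕ) :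
    ℕ → V → A.State
  | 0, v => A.init (Fintype.card V) a (ident v)
  | t + 1, v => A.recv (stateAt A G ident a t v)
      ((G.neighborFinset v).val.map fun u => A.send (stateAt A G ident a t u))

/-- The output of vertex `v`. -/
noncomputable def output (A : LocalAlgorithm Out) (G : SimpleGraph V) (ident : V → ℕ) (a : ℕ)
    (v : V) : Out :=
  A.out (A.stateAt G ident a (A.rounds (Fintype.card V) a) v)

end LocalAlgorithm

/-- Identity numbers: pairwise distinct, from the range `{1, …, n}`, `n` the number of vertices. -/
def IsIdentity {V : Type*} [Fintype V] (ident : V → ℕ) : Prop :=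
  Function.Injective ident ∧ ∀ v, 1 ≤ ident v ∧ ident v ≤ Fintype.card V

/-! ### The procedures

A procedure is given by its executions: the results of its steps, as an assignment of values to the
vertices, that its pseudocode allows. In the procedures, `C` is the constant hidden in the `O`-terms
"an `H`-partition into `O(log n)` sets" and "an `O(t ^ 2)`-coloring", and `α` is the bound on the
arboricity of the input graph. All indices and colors are numbered from `0`. -/

section Procedures

variable {V : Type*} [Fintype V]

/-- `H` is (the index function of) an `H`-partition of `G` into `O(log n)` sets, of degree
`⌊(2 + ε) α⌋`: a vertex of `H_i` has at most that many neighbors in `H_i ∪ H_{i+1} ∪ ⋯`. -/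
def IsHPartition (ε C : ℝ) (G : SimpleGraph V) (α : ℕ) (H : V → ℕ) : Prop :=
  (∀ v, (H v : ℝ) + 1 ≤ C * Real.logb 2 (Fintype.card V)) ∧
  ∀ v, {u | G.Adj v u ∧ H v ≤ H u}.ncard ≤ ⌊(2 + ε) * (α : ℝ)⌋₊

/-- `d` is, on each of the subgraphs `G(H_i)`, a `⌊α / t⌋`-defective `O(t ^ 2)`-coloring. -/
def IsDefectiveColoring (C : ℝ) (G : SimpleGraph V) (α t : ℕ) (H d : V → ℕ) : Prop :=
  (∀ v, (d v : ℝ) + 1 ≤ C * (t : ℝ) ^ 2) ∧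
  ∀ v, {u | G.Adj v u ∧ H u = H v ∧ d u = d v}.ncard ≤ α / t

/-- The parents of `v` in the partial orientation: an edge between different `H`-sets is oriented
towards the greater index, an edge inside an `H`-set towards the greater color; an edge inside an
`H`-set with endpoints of the same color is not oriented. -/
def parents (G : SimpleGraph V) (H d : V → ℕ) (v : V) : Set V :=
  {u | G.Adj v u ∧ (H v < H u ∨ (H v = H u ∧ d v < d u))}

/-- Simple-Arbdefective: every vertex selects a color among `0, …, k - 1` that is used by the
minimum number of its parents. -/
def IsSimpleArbdefective (par : V → Set V) (k : ℕ) (c : V → ℕ) : Prop :=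
  ∀ v, c v < k ∧ ∀ j < k, {u | u ∈ par v ∧ c u = c v}.ncard ≤ {u | u ∈ par v ∧ c u = j}.ncard

/-- Arbdefective-Coloring(`G`, `k`, `t`): Partial-Orientation(`G`, `t`), which computes `H` and `d`,
followed by Simple-Arbdefective on the resulting partial orientation, which computes `c`. -/
def IsArbdefectiveColoring (ε C : ℝ) (G : SimpleGraph V) (α k t : ℕ) (H d c : V → ℕ) : Prop :=
  IsHPartition ε C G α H ∧ IsDefectiveColoring C G α t H d ∧
    IsSimpleArbdefective (parents G H d) k c

/-- The value of the variable `α` after `i` iterations of the while-loop of Legal-Coloring. -/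
noncomputable def arbBound (ε : ℝ) (p a : ℕ) : ℕ → ℕ
  | 0 => a
  | i + 1 => ⌊(arbBound ε p a i : ℝ) / p + (2 + ε) * (arbBound ε p a i : ℝ) / p⌋₊

/-- What a vertex computes in Legal-Coloring: in iteration `i` of the while-loop its `H`-index, its
defective color and its arbdefective color; then its color in the legal coloring of its own final
subgraph; and its color in the resulting coloring of the whole graph. -/
structure VertexLog where
  hIndex : ℕ → ℕ
  defColor : ℕ → ℕ
  arbColor : ℕ → ℕ
  localColor : ℕ
  color : ℕ

/-- The index of the subgraph that contains `v` after `i` iterations of the while-loop. -/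
def subgraphIndex (p : ℕ) (L : V → VertexLog) : ℕ → V → ℕ
  | 0, _ => 0
  | i + 1, v => subgraphIndex p L i v * p + (L v).arbColor i

/-- `L` is the result of an execution of Legal-Coloring(`G`, `p`), where `a` is the bound on the
arboricity of `G`. The while-loop makes `r` iterations. In each of them Arbdefective-Coloring is
invoked, with `k = t = p`, in parallel on all current subgraphs. Then each subgraph, of index `z`, is
colored legally with its own palette `z * A, …, z * A + A - 1`, where `A = ⌊(2 + ε) α⌋ + 1`. -/
def IsLegalColoringExecution (ε C : ℝ) (p a : ℕ) (G : SimpleGraph V) (L : V → VertexLog) : Prop :=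
  ∃ r : ℕ,
    (∀ i < r, p < arbBound ε p a i ∧
      IsArbdefectiveColoring ε C (classGraph G (subgraphIndex p L i)) (arbBound ε p a i) p p
        (fun v => (L v).hIndex i) (fun v => (L v).defColor i) (fun v => (L v).arbColor i)) ∧
    arbBound ε p a r ≤ p ∧
    IsLegalColoring (classGraph G (subgraphIndex p L r)) (⌊(2 + ε) * (arbBound ε p a r : ℝ)⌋₊ + 1)
      (fun v => (L v).localColor) ∧
    ∀ v, (L v).color =
      subgraphIndex p L r v * (⌊(2 + ε) * (arbBound ε p a r : ℝ)⌋₊ + 1) + (L v).localColor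

end Procedures

end ArbColor

namespace ArbColor

/-! ### Sparse graphs -/

/-! The proof tracks one invariant in place of arboricity: `IsSparse`, a bound on the number of
edges spanned by every vertex set. It follows from a bound on the arboricity and equally from a
bound on the maximum degree, and it is exactly what peeling off low-degree vertices needs.

In an arbdefective coloring every vertex has at most `(2 + ε) α` parents. A color rarest among the
parents is used by at most a fraction `1 / p` of them, and at most `α / p` further neighbors are
joined by unoriented edges. Counting each oriented edge at its tail shows that a color class is
again sparse, with the next value of `α` (`IsArbdefectiveColoring.isSparse`). So an iteration
multiplies the number of subgraphs by `p` and divides `α` by at least `p / 4` (`arbBound_succ_le`).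
The choice of `p` makes `p ≤ (p / 4) ^ (1 + η)`, hence `p ^ r` is at most `p * a ^ (1 + η)` after
all `r` iterations, and each final palette has `O(p)` colors (`palette_le`).

For the distributed part, the `H`-partition arises by peeling: in a sparse graph the vertices of
high degree are a constant fraction fewer (`run_levelProg`). Defective colors come from iterated
recoloring by cubic polynomials over finite fields, which roughly takes square roots of the number
of colors and adds defects that form a convergent series (`run_shadeProg`). The colors are then
selected in decreasing order of (`H`-index, defective color), so that parents choose before their
children (`run_classProg`). The final legal coloring is the same procedure with more colors than
parents and zero defect. An iteration takes `O(log n)` rounds for fixed `p` and `ε`, and there are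
`O(log a)` iterations. -/

/-- Every set `S` of vertices spans at most `α * |S|` edges. -/
def IsSparse {V : Type*} (G : SimpleGraph V) (α : ℕ) : Prop :=
  ∀ S : Finset V, ∑ v ∈ S, {u | G.Adj v u ∧ u ∈ S}.ncard ≤ 2 * α * S.card

/-- A forest on `S` extends to a spanning tree of the complete graph on `S`, whose degree sum is `2
(|S| - 1)`. -/
theorem isSparse_one_of_isAcyclic {V : Type*} [Fintype V] {F : SimpleGraph V}
    (hF : F.IsAcyclic) : IsSparse F 1 := by
  classical
  intro S
  rcases S.eq_empty_or_nonempty with rfl | ⟨w, hw⟩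
  · simp
  let F' := F.induce (S : Set V)
  have hF' : F'.IsAcyclic := hF.induce _
  have : Nonempty (S : Set V) := ⟨⟨w, hw⟩⟩
  obtain ⟨T, hFT, -, hT⟩ :=
    (SimpleGraph.connected_top (V := (S : Set V))).exists_isTree_le_of_le_of_isAcyclic
      (le_top : F' ≤ ⊤) hF'
  have h1 := hT.card_edgeFinset
  have h2 := T.sum_degrees_eq_twice_card_edges
  have h3 : Fintype.card (S : Set V) = S.card := by simp
  have h4 : ∑ v ∈ S, {u | F.Adj v u ∧ u ∈ S}.ncard ≤ ∑ v : (S : Set V), T.degree v := by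
    rw [← Finset.sum_coe_sort S]
    refine Finset.sum_le_sum fun v _ => ?_
    have : {u | F.Adj v u ∧ u ∈ S} ⊆ Subtype.val '' (T.neighborSet v) := by
      rintro u ⟨hu, huS⟩
      exact ⟨⟨u, huS⟩, hFT (show F.Adj _ _ from hu), rfl⟩
    refine (Set.ncard_le_ncard this (Set.toFinite _)).trans ?_
    refine (Set.ncard_image_le (Set.toFinite _)).trans ?_
    rw [Set.ncard_eq_toFinset_card', ← SimpleGraph.card_neighborFinset_eq_degree]
    exact le_of_eq (by congr 1)
  calc _ ≤ _ := h4
    _ = 2 * T.edgeFinset.card := h2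
    _ ≤ 2 * 1 * S.card := by omega

/-- One forest per edge. This makes the infimum defining `arboricity` attained; over an empty set it
would be the meaningless value `0`. -/
theorem exists_hasForestDecomposition {V : Type*} [Fintype V] (G : SimpleGraph V) :
    ∃ k, HasForestDecomposition G k := by
  classical
  let e := Fintype.equivFin G.edgeSet
  refine ⟨Fintype.card G.edgeSet, fun i => SimpleGraph.fromEdgeSet {(e.symm i : Sym2 V)},
    fun i => ?_, fun i j hij => ?_, ?_⟩
  · beta_reduce
    obtain ⟨s, hs⟩ := e.symm i
    induction s with | _ u v
    have hne : u ≠ v := G.ne_of_adj hs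
    have h := SimpleGraph.IsAcyclic.sup_edge_of_not_reachable (u := u) (v := v)
      (G := (⊥ : SimpleGraph V)) (by simpa using hne) SimpleGraph.isAcyclic_bot
    rwa [bot_sup_eq] at h
  · rw [SimpleGraph.fromEdgeSet_disjoint, Set.disjoint_left]
    intro s hs hs'
    rw [SimpleGraph.edgeSet_fromEdgeSet] at hs'
    apply hij
    have h1 : (s : Sym2 V) = e.symm i := hs
    have h2 : (s : Sym2 V) = e.symm j := hs'.1
    exact e.symm.injective (Subtype.ext (h1.symm.trans h2))
  · ext u v
    simp only [SimpleGraph.iSup_adj, SimpleGraph.fromEdgeSet_adj, Set.mem_singleton_iff]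
    constructor
    · rintro ⟨i, hi, -⟩
      have := (e.symm i).2
      rw [← hi] at this
      exact this
    · intro h
      exact ⟨e ⟨s(u, v), h⟩, by simp, h.ne⟩

theorem isSparse_of_arboricity_le {V : Type*} [Fintype V] {G : SimpleGraph V} {a : ℕ}
    (h : arboricity G ≤ a) : IsSparse G a := by
  have hk : HasForestDecomposition G (arboricity G) :=
    Nat.sInf_mem (s := {k | HasForestDecomposition G k}) (exists_hasForestDecomposition G)
  obtain ⟨F, hF, -, hFG⟩ := hk
  intro S
  calc _ ≤ ∑ v ∈ S, ∑ i, {u | (F i).Adj v u ∧ u ∈ S}.ncard := by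
        refine Finset.sum_le_sum fun v _ => ?_
        refine (Set.ncard_le_ncard ?_ (Set.toFinite _)).trans (Set.ncard_iUnion_le_of_fintype _)
        rintro u ⟨hu, huS⟩
        rw [← hFG, SimpleGraph.iSup_adj] at hu
        obtain ⟨i, hi⟩ := hu
        exact Set.mem_iUnion.2 ⟨i, hi, huS⟩
    _ = ∑ i, ∑ v ∈ S, {u | (F i).Adj v u ∧ u ∈ S}.ncard := Finset.sum_comm
    _ ≤ ∑ i : Fin (arboricity G), 2 * 1 * S.card :=
        Finset.sum_le_sum fun i _ => isSparse_one_of_isAcyclic (hF i) S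
    _ = 2 * arboricity G * S.card := by simp; ring
    _ ≤ _ := by gcongr

/-- The degree sum over `S` is at most `Δ |S|`, half of what is allowed. This lets the maximum
degree replace `a` without comparing it to the arboricity. -/
theorem isSparse_maxDegree {V : Type*} [Fintype V] (G : SimpleGraph V) [DecidableRel G.Adj] :
    IsSparse G G.maxDegree := by
  classical
  intro S
  calc _ ≤ ∑ v ∈ S, G.maxDegree := by
        refine Finset.sum_le_sum fun v _ => le_trans ?_ (G.degree_le_maxDegree v)
        rw [← SimpleGraph.card_neighborFinset_eq_degree, ← Set.ncard_coe_finset]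
        exact Set.ncard_le_ncard (fun u hu => by simpa using hu.1) (Set.toFinite _)
    _ = 1 * G.maxDegree * S.card := by simp [mul_comm]
    _ ≤ _ := by gcongr; norm_num

/-- Few vertices of a sparse graph have high degree. -/
theorem IsSparse.card_filter_le {V : Type*} [Fintype V] {G : SimpleGraph V} {α : ℕ}
    (hG : IsSparse G α) (hα : 0 < α) {ε : ℝ} (hε : 0 < ε) (S T : Finset V) (hTS : T ⊆ S)
    (hT : ∀ v ∈ T, ⌊(2 + ε) * (α : ℝ)⌋₊ < {u | G.Adj v u ∧ u ∈ S}.ncard) :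
    (1 + ε / 2) * (T.card : ℝ) ≤ S.card := by
  have h1 : (T.card : ℝ) * ((2 + ε) * α) ≤ 2 * α * S.card := by
    calc (T.card : ℝ) * ((2 + ε) * α) = ∑ v ∈ T, (2 + ε) * (α : ℝ) := by simp
      _ ≤ ∑ v ∈ T, ({u | G.Adj v u ∧ u ∈ S}.ncard : ℝ) :=
          Finset.sum_le_sum fun v hv => ((Nat.floor_lt (by positivity)).1 (hT v hv)).le
      _ ≤ ∑ v ∈ S, ({u | G.Adj v u ∧ u ∈ S}.ncard : ℝ) :=
          Finset.sum_le_sum_of_subset_of_nonneg hTS fun _ _ _ => by positivity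
      _ ≤ 2 * α * S.card := by exact_mod_cast hG S
  have hα' : (0 : ℝ) < α := by exact_mod_cast hα
  refine le_of_mul_le_mul_right ?_ (show (0 : ℝ) < 2 * α by positivity)
  linarith

/-- A graph in which the neighbors of each vertex are its parents, its children and at most
`x` others is sparse. -/
theorem isSparse_of_orientation {V : Type*} [Fintype V] {G : SimpleGraph V}
    (P Q : V → V → Prop) (hPQ : ∀ v u, G.Adj v u → P v u ∨ P u v ∨ Q v u) {x y α : ℕ}
    (hP : ∀ v, {u | P v u}.ncard ≤ y) (hQ : ∀ v, {u | Q v u}.ncard ≤ x) (hα : x + y ≤ α) :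
    IsSparse G α := by
  classical
  intro S
  -- Double counting of the oriented edges inside `S`: total in-degree equals total out-degree, so
  -- bounding the parents also controls the children.
  have hswap : ∑ v ∈ S, {u | P u v ∧ u ∈ S}.ncard = ∑ v ∈ S, {u | P v u ∧ u ∈ S}.ncard := by
    have key := Finset.sum_card_bipartiteAbove_eq_sum_card_bipartiteBelow (s := S) (t := S) P
    rw [eq_comm]
    convert key using 1
    · refine Finset.sum_congr rfl fun v _ => ?_
      rw [← Set.ncard_coe_finset]; congr 1; ext u
      simp [Finset.bipartiteAbove, and_comm]
    · refine Finset.sum_congr rfl fun v _ => ?_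
      rw [← Set.ncard_coe_finset]; congr 1; ext u
      simp [Finset.bipartiteBelow, and_comm]
  have hPS : ∀ v, {u | P v u ∧ u ∈ S}.ncard ≤ y := fun v =>
    (Set.ncard_le_ncard (fun u hu => hu.1) (Set.toFinite _)).trans (hP v)
  calc _ ≤ ∑ v ∈ S, ({u | P v u ∧ u ∈ S}.ncard + {u | P u v ∧ u ∈ S}.ncard + x) := by
        refine Finset.sum_le_sum fun v _ => ?_
        have : {u | G.Adj v u ∧ u ∈ S} ⊆
            ({u | P v u ∧ u ∈ S} ∪ {u | P u v ∧ u ∈ S}) ∪ {u | Q v u} := by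
          rintro u ⟨hu, huS⟩
          rcases hPQ v u hu with h | h | h
          · exact Or.inl (Or.inl ⟨h, huS⟩)
          · exact Or.inl (Or.inr ⟨h, huS⟩)
          · exact Or.inr h
        refine (Set.ncard_le_ncard this (Set.toFinite _)).trans ?_
        refine (Set.ncard_union_le _ _).trans ?_
        gcongr
        · exact Set.ncard_union_le _ _
        · exact hQ v
    _ = ∑ v ∈ S, (2 * {u | P v u ∧ u ∈ S}.ncard + x) := by
        simp only [Finset.sum_add_distrib, hswap, two_mul]
    _ ≤ ∑ v ∈ S, (2 * α) := by
        refine Finset.sum_le_sum fun v _ => ?_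
        have := hPS v
        omega
    _ = _ := by simp [mul_comm]

/-! ### Arbdefective colorings -/

section Arbdefective

variable {V : Type*} [Fintype V]

/-- A color used by the fewest members of a set is used by at most a fraction `1 / k` of them. -/
theorem IsSimpleArbdefective.mul_ncard_le {par : V → Set V} {k : ℕ} {c : V → ℕ}
    (h : IsSimpleArbdefective par k c) (v : V) :
    k * {u | u ∈ par v ∧ c u = c v}.ncard ≤ (par v).ncard := by
  classical
  have hdisj : ((Finset.range k : Finset ℕ) : Set ℕ).PairwiseDisjoint
      fun j => (Set.toFinite {u | u ∈ par v ∧ c u = j}).toFinset := by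
    intro i _ j _ hij
    rw [Function.onFun, Finset.disjoint_left]
    intro u hu hu'
    simp only [Set.Finite.mem_toFinset, Set.mem_ofPred_eq] at hu hu'
    exact hij (hu.2.symm.trans hu'.2)
  calc k * {u | u ∈ par v ∧ c u = c v}.ncard
      = ∑ j ∈ Finset.range k, {u | u ∈ par v ∧ c u = c v}.ncard := by simp
    _ ≤ ∑ j ∈ Finset.range k, {u | u ∈ par v ∧ c u = j}.ncard :=
        Finset.sum_le_sum fun j hj => (h v).2 j (Finset.mem_range.1 hj)
    _ = ((Finset.range k).biUnion
          fun j => (Set.toFinite {u | u ∈ par v ∧ c u = j}).toFinset).card := by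
        rw [Finset.card_biUnion hdisj]
        exact Finset.sum_congr rfl fun j _ => Set.ncard_eq_toFinset_card _ _
    _ ≤ (par v).ncard := by
        rw [← Set.ncard_coe_finset]
        refine Set.ncard_le_ncard ?_ (Set.toFinite _)
        intro u hu
        simp only [Finset.coe_biUnion, Set.mem_iUnion, Set.Finite.coe_toFinset] at hu
        obtain ⟨j, -, hj⟩ := hu
        exact hj.1

theorem IsHPartition.ncard_parents_le {ε C : ℝ} {G : SimpleGraph V} {α : ℕ} {H : V → ℕ}
    (h : IsHPartition ε C G α H) (d : V → ℕ) (v : V) :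
    (parents G H d v).ncard ≤ ⌊(2 + ε) * (α : ℝ)⌋₊ := by
  refine (Set.ncard_le_ncard ?_ (Set.toFinite _)).trans (h.2 v)
  rintro u ⟨hu, hu' | hu'⟩
  · exact ⟨hu, hu'.le⟩
  · exact ⟨hu, hu'.1.le⟩

/-- Neighbors are joined by an oriented edge or share their `H`-set and defective color. -/
theorem parents_trichotomy {V : Type*} {G : SimpleGraph V} (H d : V → ℕ) {v u : V} (h : G.Adj v u) :
    u ∈ parents G H d v ∨ v ∈ parents G H d u ∨ (G.Adj v u ∧ H u = H v ∧ d u = d v) := by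
  simp only [parents, Set.mem_ofPred_eq, h, h.symm, true_and]
  omega

/-- The color classes of an arbdefective coloring with `k = t = p` are sparse. -/
theorem IsArbdefectiveColoring.isSparse {ε C : ℝ} (hε : 0 < ε) {G : SimpleGraph V} {α p : ℕ}
    (hp : 0 < p) {H d c : V → ℕ} (h : IsArbdefectiveColoring ε C G α p p H d c) :
    IsSparse (classGraph G c) ⌊(α : ℝ) / p + (2 + ε) * (α : ℝ) / p⌋₊ := by
  obtain ⟨hH, hd, hc⟩ := h
  refine isSparse_of_orientation (fun v u => u ∈ parents G H d v ∧ c u = c v)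
    (fun v u => G.Adj v u ∧ H u = H v ∧ d u = d v) (x := α / p)
    (y := ⌊(2 + ε) * (α : ℝ)⌋₊ / p) ?_ ?_ hd.2 ?_
  · rintro v u ⟨hvu, hcvu⟩
    rcases parents_trichotomy H d hvu with h | h | h
    · exact Or.inl ⟨h, hcvu.symm⟩
    · exact Or.inr (Or.inl ⟨h, hcvu⟩)
    · exact Or.inr (Or.inr h)
  · intro v
    rw [Nat.le_div_iff_mul_le hp, mul_comm]
    exact (hc.mul_ncard_le v).trans (hH.ncard_parents_le d v)
  · apply Nat.le_floor
    push_cast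
    have h1 : ((α / p : ℕ) : ℝ) ≤ (α : ℝ) / p := Nat.cast_div_le
    have h2 : ((⌊(2 + ε) * (α : ℝ)⌋₊ / p : ℕ) : ℝ) ≤ (2 + ε) * (α : ℝ) / p :=
      Nat.cast_div_le.trans (by gcongr; exact Nat.floor_le (by positivity))
    linarith

/-- If no edge is left unoriented, more colors than parents give a legal coloring. -/
theorem IsArbdefectiveColoring.isLegalColoring {ε C : ℝ} {G : SimpleGraph V} {α t : ℕ}
    (ht : α < t) {H d c : V → ℕ}
    (h : IsArbdefectiveColoring ε C G α (⌊(2 + ε) * (α : ℝ)⌋₊ + 1) t H d c) :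
    IsLegalColoring G (⌊(2 + ε) * (α : ℝ)⌋₊ + 1) c := by
  obtain ⟨hH, hd, hc⟩ := h
  refine ⟨fun v => (hc v).1, ?_⟩
  have key : ∀ v u, u ∈ parents G H d v → c u ≠ c v := by
    intro v u hu hcu
    -- There are more colors than parents, so even one parent sharing the color of `v` would
    -- contradict the averaging bound.
    have h1 := (hc.mul_ncard_le v).trans (hH.ncard_parents_le d v)
    have h2 : 0 < {u | u ∈ parents G H d v ∧ c u = c v}.ncard :=
      (Set.ncard_pos (Set.toFinite _)).2 ⟨u, hu, hcu⟩
    nlinarith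
  intro v u hvu
  rcases parents_trichotomy H d hvu with h | h | h
  · exact (key v u h).symm
  · exact key u v h
  -- Since `α < t`, the allowed defect `α / t` is zero in natural number division.
  · have h1 := hd.2 v
    rw [Nat.div_eq_of_lt ht, Nat.le_zero, Set.ncard_eq_zero (Set.toFinite _)] at h1
    exact absurd (show u ∈ (∅ : Set V) from h1 ▸ h) (Set.notMem_empty u)

end Arbdefective

/-! ### The number of iterations and colors -/

/-- The factor is `(3 + ε) / p`, and `3 + ε < 4`. -/
theorem arbBound_succ_le {ε : ℝ} (hε : 0 < ε) (hε1 : ε < 1) {p : ℕ} (hp : 0 < p) (a i : ℕ) :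
    (p : ℝ) / 4 * arbBound ε p a (i + 1) ≤ arbBound ε p a i := by
  have hp' : (0 : ℝ) < p := by exact_mod_cast hp
  have h : (arbBound ε p a (i + 1) : ℝ) ≤
      (arbBound ε p a i : ℝ) / p + (2 + ε) * (arbBound ε p a i : ℝ) / p :=
    Nat.floor_le (by positivity)
  calc (p : ℝ) / 4 * arbBound ε p a (i + 1)
      ≤ (p : ℝ) / 4 * ((arbBound ε p a i : ℝ) / p + (2 + ε) * (arbBound ε p a i : ℝ) / p) := by
        gcongr
    _ = (3 + ε) / 4 * arbBound ε p a i := by field_simp; ring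
    _ ≤ 1 * arbBound ε p a i := by gcongr; linarith
    _ = _ := one_mul _

theorem pow_mul_arbBound_le {ε : ℝ} (hε : 0 < ε) (hε1 : ε < 1) {p : ℕ} (hp : 0 < p) (a i : ℕ) :
    ((p : ℝ) / 4) ^ i * arbBound ε p a i ≤ a := by
  induction i with
  | zero => simp [arbBound]
  | succ i ih =>
    refine le_trans ?_ ih
    rw [pow_succ, mul_assoc]
    gcongr
    exact arbBound_succ_le hε hε1 hp a i

theorem subgraphIndex_lt {V : Type*} {p : ℕ} (L : V → VertexLog) {r : ℕ}
    (h : ∀ i < r, ∀ v, (L v).arbColor i < p) (v : V) : subgraphIndex p L r v < p ^ r := by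
  induction r with
  | zero => simp [subgraphIndex]
  | succ r ih =>
    have h1 := ih fun i hi => h i (by omega)
    have h2 := h r (by omega) v
    rw [subgraphIndex, pow_succ]
    calc _ < subgraphIndex p L r v * p + p := by omega
      _ = (subgraphIndex p L r v + 1) * p := by ring
      _ ≤ p ^ r * p := by gcongr; exact h1

/-- With `s = ⌈1 / η⌉` this says `4 s ≤ (4 s - 2) (1 + η)`, that is `2 + 2 η ≤ 4 η s`, which follows
from `η s ≥ 1` and `s ≥ 1`. The constant `c = 4` is chosen for this. -/
theorem le_rpow_of_eq_two_pow {η : ℝ} (hη : 0 < η) {p : ℕ} (hp : p = 2 ^ (4 * ⌈1 / η⌉₊)) :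
    (p : ℝ) ≤ ((p : ℝ) / 4) ^ (1 + η) := by
  have hs : 1 ≤ η * ⌈1 / η⌉₊ := by
    have := Nat.le_ceil (1 / η)
    rwa [div_le_iff₀ hη, mul_comm] at this
  have hs1 : (1 : ℝ) ≤ ⌈1 / η⌉₊ := by
    exact_mod_cast Nat.ceil_pos.2 (by positivity)
  have hpr : (p : ℝ) = 2 ^ (4 * (⌈1 / η⌉₊ : ℝ)) := by
    rw [hp]; push_cast; rw [← Real.rpow_natCast]; push_cast; rfl
  have hpr4 : (p : ℝ) / 4 = 2 ^ (4 * (⌈1 / η⌉₊ : ℝ) - 2) := by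
    rw [hpr, Real.rpow_sub two_pos]; norm_num
  rw [hpr4, ← Real.rpow_mul two_pos.le, hpr]
  apply Real.rpow_le_rpow_of_exponent_le one_le_two
  nlinarith

theorem sixteen_le_of_eq_two_pow {η : ℝ} (hη : 0 < η) {p : ℕ} (hp : p = 2 ^ (4 * ⌈1 / η⌉₊)) :
    16 ≤ p := by
  have hs1 : 1 ≤ ⌈1 / η⌉₊ := Nat.ceil_pos.2 (by positivity)
  rw [hp]
  calc 16 = 2 ^ (4 * 1) := by norm_num
    _ ≤ _ := Nat.pow_le_pow_right two_pos (by omega)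

/-- The final palette has `O(a ^ (1 + η))` colors. -/
theorem palette_le {ε : ℝ} (hε : 0 < ε) (hε1 : ε < 1) {η : ℝ} (hη : 0 < η) {p : ℕ}
    (hp : p = 2 ^ (4 * ⌈1 / η⌉₊)) {a r : ℕ} (ha : 1 ≤ a) (hr : ∀ i < r, p < arbBound ε p a i)
    (hr' : arbBound ε p a r ≤ p) {K : ℝ} (hK : (p : ℝ) * (3 * p + 1) ≤ K) :
    p ^ r * (⌊(2 + ε) * (arbBound ε p a r : ℝ)⌋₊ + 1) ≤ ⌊K * (a : ℝ) ^ (1 + η)⌋₊ := by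
  have h16 := sixteen_le_of_eq_two_pow hη hp
  have hp1 : (1 : ℝ) ≤ p := by exact_mod_cast (by omega : 1 ≤ p)
  have ha1 : (1 : ℝ) ≤ a := by exact_mod_cast ha
  -- The bound before the last iteration exceeds `p ≥ 1`, so `(p / 4) ^ (r - 1) ≤ a`; the last
  -- iteration costs the extra factor `p`.
  have hpow : (p : ℝ) ^ r ≤ p * (a : ℝ) ^ (1 + η) := by
    rcases r with _ | r
    · rw [pow_zero]
      exact one_le_mul_of_one_le_of_one_le hp1 (Real.one_le_rpow ha1 (by linarith))
    · rw [pow_succ, mul_comm]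
      gcongr
      have h1 := pow_mul_arbBound_le hε hε1 (by omega : 0 < p) a r
      have h2 : (1 : ℝ) ≤ arbBound ε p a r := by
        exact_mod_cast (by have := hr r (by omega); omega : 1 ≤ arbBound ε p a r)
      have h3 : ((p : ℝ) / 4) ^ r ≤ a :=
        le_trans (le_mul_of_one_le_right (by positivity) h2) h1
      calc (p : ℝ) ^ r ≤ (((p : ℝ) / 4) ^ (1 + η)) ^ r := by
            gcongr; exact le_rpow_of_eq_two_pow hη hp
        _ = (((p : ℝ) / 4) ^ r) ^ (1 + η) := by
            rw [← Real.rpow_natCast, ← Real.rpow_natCast, ← Real.rpow_mul (by positivity),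
              ← Real.rpow_mul (by positivity), mul_comm]
        _ ≤ (a : ℝ) ^ (1 + η) := by gcongr
  have hA : ((⌊(2 + ε) * (arbBound ε p a r : ℝ)⌋₊ : ℝ) + 1) ≤ 3 * p + 1 := by
    gcongr
    refine (Nat.floor_le (by positivity)).trans ?_
    gcongr
    linarith
  apply Nat.le_floor
  push_cast
  calc _ ≤ (p * (a : ℝ) ^ (1 + η)) * (3 * p + 1) := by gcongr
    _ = (p : ℝ) * (3 * p + 1) * (a : ℝ) ^ (1 + η) := by ring
    _ ≤ _ := by gcongr

/-- Every execution of Legal-Coloring yields a legal coloring with `O(a ^ (1 + η))` colors. -/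
theorem IsLegalColoringExecution.isLegalColoring {V : Type*} [Fintype V] {ε C : ℝ} (hε : 0 < ε)
    (hε1 : ε < 1) {η : ℝ} (hη : 0 < η) {p : ℕ} (hp : p = 2 ^ (4 * ⌈1 / η⌉₊)) {a : ℕ}
    (ha : 1 ≤ a) {K : ℝ} (hK : (p : ℝ) * (3 * p + 1) ≤ K) {G : SimpleGraph V}
    {L : V → VertexLog} (h : IsLegalColoringExecution ε C p a G L) :
    IsLegalColoring G ⌊K * (a : ℝ) ^ (1 + η)⌋₊ (fun v => (L v).color) := by
  obtain ⟨r, hr, hr', hleg, hcol⟩ := h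
  set A := ⌊(2 + ε) * (arbBound ε p a r : ℝ)⌋₊ + 1 with hA
  have hidx := subgraphIndex_lt L (p := p) (r := r) fun i hi v => ((hr i hi).2.2.2 v).1
  constructor
  · intro v
    refine lt_of_lt_of_le ?_ (palette_le hε hε1 hη hp ha (fun i hi => (hr i hi).1) hr' hK)
    rw [← hA]
    show (L v).color < _
    rw [hcol]
    have h1 : (L v).localColor < A := hleg.1 v
    calc _ < subgraphIndex p L r v * A + A := by omega
      _ = (subgraphIndex p L r v + 1) * A := by ring
      _ ≤ p ^ r * A := by gcongr; exact hidx v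
  · intro u v huv heq
    simp only [hcol] at heq
    have hu : (L u).localColor < A := hleg.1 u
    have hv : (L v).localColor < A := hleg.1 v
    have hz : subgraphIndex p L r u = subgraphIndex p L r v := by
      have hdiv : ∀ w, (L w).localColor < A →
          (subgraphIndex p L r w * A + (L w).localColor) / A = subgraphIndex p L r w := by
        intro w hw
        rw [mul_comm, Nat.mul_add_div (by omega), Nat.div_eq_of_lt hw, add_zero]
      rw [← hdiv u hu, ← hdiv v hv, heq]
    refine hleg.2 u v ⟨huv, hz⟩ ?_
    show (L u).localColor = (L v).localColor
    rw [hz] at heq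
    omega


/-! ### Families of functions with few agreements -/

/-- The functions `f 0, …, f (q ^ 4 - 1)` from `{0, …, q - 1}` to itself pairwise agree in at most
three places. -/
def IsSpread (q : ℕ) (f : ℕ → ℕ → ℕ) : Prop :=
  (∀ c x, f c x < q) ∧
    ∀ c < q ^ 4, ∀ c' < q ^ 4, c ≠ c' → {x ∈ Finset.range q | f c x = f c' x}.card ≤ 3

open Polynomial in
/-- Such a family is given by the polynomials of degree at most three over a finite field. -/
theorem exists_isSpread {b : ℕ} (hb : b ≠ 0) : ∃ f, IsSpread (2 ^ b) f := by
  classical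
  let F := GaloisField 2 b
  have hcard : Nat.card F = 2 ^ b := GaloisField.card 2 b hb
  set q := 2 ^ b with hq
  have hq0 : 0 < q := by positivity
  have : Finite F := Nat.finite_of_card_ne_zero (by omega)
  let e : F ≃ Fin q := Finite.equivFinOfCardEq hcard
  let _ : Fintype F := Fintype.ofFinite F
  have hF : Fintype.card F = q := by rw [← Nat.card_eq_fintype_card, hcard]
  have hcard4 : Fintype.card (Fin 4 → F) = q ^ 4 := by simp [hF]
  let g : Fin (q ^ 4) ≃ degreeLT F 4 :=
    (Fintype.equivFinOfCardEq hcard4).symm.trans (degreeLTEquiv F 4).symm.toEquiv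
  -- Polynomials of degree at most three have four coefficients, hence the `q ^ 4` indices. The
  -- default value `0` keeps all values below `q` outside the meaningful range.
  refine ⟨fun c x => if h : c < q ^ 4 ∧ x < q then e ((g ⟨c, h.1⟩ : F[X]).eval (e.symm ⟨x, h.2⟩))
    else 0, ?_, ?_⟩
  · intro c x
    dsimp only
    split_ifs
    · exact Fin.is_lt _
    · exact hq0
  · intro c hc c' hc' hne
    -- Places of agreement are roots of the difference, a nonzero polynomial of degree at most
    -- three.
    set P : F[X] := (g ⟨c, hc⟩ : F[X]) - (g ⟨c', hc'⟩ : F[X]) with hP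
    have hPmem : P ∈ degreeLT F 4 := Submodule.sub_mem _ (g ⟨c, hc⟩).2 (g ⟨c', hc'⟩).2
    have hP0 : P ≠ 0 := by
      intro h0
      apply hne
      have := g.injective (Subtype.ext (sub_eq_zero.1 h0))
      simpa using this
    have hdeg : P.natDegree ≤ 3 := by
      have := (natDegree_lt_iff_degree_lt hP0).2 (mem_degreeLT.1 hPmem)
      omega
    calc _ ≤ (P.roots.toFinset.image fun y => (e y : ℕ)).card := by
          refine Finset.card_le_card fun x hx => ?_
          rw [Finset.mem_filter, Finset.mem_range] at hx
          obtain ⟨hx, hxe⟩ := hx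
          beta_reduce at hxe
          rw [dif_pos ⟨hc, hx⟩, dif_pos ⟨hc', hx⟩] at hxe
          refine Finset.mem_image.2 ⟨e.symm ⟨x, hx⟩, ?_, by simp⟩
          rw [Multiset.mem_toFinset, mem_roots hP0, IsRoot, hP, eval_sub, sub_eq_zero]
          exact e.injective (Fin.ext hxe)
      _ ≤ P.roots.toFinset.card := Finset.card_image_le
      _ ≤ P.roots.card := Multiset.toFinset_card_le _
      _ ≤ P.natDegree := card_roots' P
      _ ≤ 3 := hdeg

/-- A fixed family of functions with few agreements. -/
noncomputable def spreadFamily (q : ℕ) : ℕ → ℕ → ℕ := Classical.epsilon (IsSpread q)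

theorem isSpread_spreadFamily {b : ℕ} (hb : b ≠ 0) : IsSpread (2 ^ b) (spreadFamily (2 ^ b)) :=
  Classical.epsilon_spec (exists_isSpread hb)

/-- An element of `{0, …, k - 1}` at which `w` is smallest. -/
noncomputable def pick (k : ℕ) (w : ℕ → ℕ) : ℕ :=
  if h : 0 < k then ((Finset.range k).exists_min_image w ⟨0, Finset.mem_range.2 h⟩).choose else 0

theorem pick_spec {k : ℕ} (hk : 0 < k) (w : ℕ → ℕ) :
    pick k w < k ∧ ∀ j < k, w (pick k w) ≤ w j := by
  have h := ((Finset.range k).exists_min_image w ⟨0, Finset.mem_range.2 hk⟩).choose_spec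
  rw [pick, dif_pos hk]
  exact ⟨Finset.mem_range.1 h.1, fun j hj => h.2 j (Finset.mem_range.2 hj)⟩

/-! ### Programs: sequences of rounds -/

/-- The memory of a vertex: its identity number, the index of its current subgraph, its `H`-index,
defective color and arbdefective color in the current iteration, and the recorded results. -/
structure VertexState where
  ident : ℕ
  part : ℕ
  level : ℕ
  shade : ℕ
  cls : ℕ
  log : VertexLog

/-- What a vertex does in a round: it updates its state, given those of its neighbors. -/
abbrev Step := VertexState → Multiset VertexState → VertexState

section Run

variable {V : Type*} [Fintype V]

open Classical in
/-- All vertices perform the step `f`. -/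
noncomputable def round (G : SimpleGraph V) (f : Step) (σ : V → VertexState) (v : V) :
    VertexState :=
  f (σ v) ((G.neighborFinset v).val.map σ)

/-- All vertices perform a sequence of steps. -/
noncomputable def run (G : SimpleGraph V) : List Step → (V → VertexState) → V → VertexState
  | [], σ => σ
  | f :: l, σ => run G l (round G f σ)

theorem run_append (G : SimpleGraph V) (l l' : List Step) (σ : V → VertexState) :
    run G (l ++ l') σ = run G l' (run G l σ) := by
  induction l generalizing σ with
  | nil => rfl
  | cons f l ih => exact ih _

/-- The initial state of the vertex with identity number `i`. -/
def initialState (i : ℕ) : VertexState := ⟨i, 0, 0, 0, 0, ⟨0, 0, 0, 0, 0⟩⟩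

/-- The algorithm that performs the program `prog n a`. Its states contain the remaining steps. -/
def algorithmOf (prog : ℕ → ℕ → List Step) : LocalAlgorithm VertexLog where
  State := VertexState × List Step
  Msg := VertexState
  init n a i := (initialState i, prog n a)
  send s := s.1
  recv s ms := match s.2 with
    | [] => s
    | f :: l => (f s.1 ms, l)
  rounds n a := (prog n a).length
  out s := s.1.log

/-- All vertices start with the same program and drop one step per round, so they stay in lockstep
and the simulation reduces to `run`. -/
theorem algorithmOf_stateAt (prog : ℕ → ℕ → List Step) (G : SimpleGraph V) (ident : V → ℕ)
    (a t : ℕ) (v : V) :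
    (algorithmOf prog).stateAt G ident a t v =
      (run G ((prog (Fintype.card V) a).take t) (fun v => initialState (ident v)) v,
        (prog (Fintype.card V) a).drop t) := by
  induction t generalizing v with
  | zero => rfl
  | succ t ih =>
    rw [LocalAlgorithm.stateAt, ih]
    simp only [ih]
    rcases h : (prog (Fintype.card V) a).drop t with _ | ⟨f, l⟩
    · have hlen := List.drop_eq_nil_iff.1 h
      have h1 : (prog (Fintype.card V) a).drop (t + 1) = [] := List.drop_eq_nil_iff.2 (by omega)
      have h2 : (prog (Fintype.card V) a).take (t + 1) = (prog (Fintype.card V) a).take t := by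
        rw [List.take_of_length_le (by omega), List.take_of_length_le hlen]
      rw [h1, h2]
      rfl
    · have h1 : (prog (Fintype.card V) a).drop (t + 1) = l := by
        rw [← List.drop_drop, h]; rfl
      have h2 : (prog (Fintype.card V) a).take (t + 1) =
          (prog (Fintype.card V) a).take t ++ [f] := by
        rw [List.take_add, h]; rfl
      rw [h1, h2, run_append]
      rfl

theorem algorithmOf_output (prog : ℕ → ℕ → List Step) (G : SimpleGraph V) (ident : V → ℕ)
    (a : ℕ) (v : V) :
    (algorithmOf prog).output G ident a v =
      (run G (prog (Fintype.card V) a) (fun v => initialState (ident v)) v).log := by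
  rw [LocalAlgorithm.output, algorithmOf_stateAt]
  simp only [algorithmOf, List.take_length]

/-- The states with the given components. -/
def pack (i z h d c : V → ℕ) (l : V → VertexLog) (v : V) : VertexState :=
  ⟨i v, z v, h v, d v, c v, l v⟩

open Classical in
/-- The number of neighbors in the same subgraph that satisfy `P`. -/
noncomputable def tally (s : VertexState) (P : VertexState → Prop) (ms : Multiset VertexState) :
    ℕ :=
  (ms.filter fun u => s.part = u.part ∧ P u).card

-- Messages arrive as a multiset, so neighbors in equal states are counted separately; a tally is
-- therefore a genuine number of neighbors in the current subgraph.
open Classical in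
theorem tally_pack (G : SimpleGraph V) (i z h d c : V → ℕ) (l : V → VertexLog) (v : V)
    (P : VertexState → Prop) :
    tally (pack i z h d c l v) P ((G.neighborFinset v).val.map (pack i z h d c l)) =
      {u | (classGraph G z).Adj v u ∧ P (pack i z h d c l u)}.ncard := by
  rw [tally, Multiset.filter_map, Multiset.card_map, ← Finset.filter_val, ← Finset.card_def,
    ← Set.ncard_coe_finset]
  congr 1
  ext u
  rw [Finset.mem_coe, Finset.mem_filter, SimpleGraph.mem_neighborFinset]
  exact and_assoc.symm

/-! ### The `H`-partition -/

/-- A vertex of level `j` with too many neighbors of level `j` moves to level `j + 1`. -/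
noncomputable def levelStep (thr j : ℕ) : Step := fun s ms =>
  if s.level = j ∧ thr < tally s (fun u => u.level = j) ms then { s with level := j + 1 } else s

/-- The first `j` rounds of the computation of the `H`-partition. -/
noncomputable def levelProg (thr : ℕ) : ℕ → List Step
  | 0 => []
  | j + 1 => levelProg thr j ++ [levelStep thr j]

theorem length_levelProg (thr j : ℕ) : (levelProg thr j).length = j := by
  induction j with
  | zero => rfl
  | succ j ih => simp [levelProg, ih]

theorem round_levelStep (G : SimpleGraph V) (thr j : ℕ) (i z h d c : V → ℕ) (l : V → VertexLog) :
    round G (levelStep thr j) (pack i z h d c l) =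
      pack i z (fun v => if h v = j ∧ thr < {u | (classGraph G z).Adj v u ∧ h u = j}.ncard
        then j + 1 else h v) d c l := by
  funext v
  simp only [round, levelStep, tally_pack]
  by_cases hv : h v = j ∧ thr < {u | (classGraph G z).Adj v u ∧ h u = j}.ncard
  · exact (if_pos hv).trans (by simp only [pack, if_pos hv])
  · exact (if_neg hv).trans (by simp only [pack, if_neg hv])

/-- Invariant of the peeling: a vertex left below level `j` is settled with few neighbors at its own
level or above, and the unsettled vertices shrink by the factor `1 + ε / 2` per round. -/
theorem run_levelProg (G : SimpleGraph V) (i z d c : V → ℕ) (l : V → VertexLog) {α : ℕ}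
    (hG : IsSparse (classGraph G z) α) (hα : 0 < α) {ε : ℝ} (hε : 0 < ε) (j : ℕ) :
    ∃ h : V → ℕ,
      run G (levelProg ⌊(2 + ε) * (α : ℝ)⌋₊ j) (pack i z 0 d c l) = pack i z h d c l ∧
      (∀ v, h v ≤ j) ∧
      (∀ v, h v < j →
        {u | (classGraph G z).Adj v u ∧ h v ≤ h u}.ncard ≤ ⌊(2 + ε) * (α : ℝ)⌋₊) ∧
      (1 + ε / 2) ^ j * (Finset.card {v | h v = j} : ℝ) ≤ Fintype.card V := by
  classical
  set thr := ⌊(2 + ε) * (α : ℝ)⌋₊ with hthr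
  induction j with
  | zero => exact ⟨0, rfl, fun v => le_rfl, by simp, by simp [Finset.card_univ]⟩
  | succ j ih =>
    obtain ⟨h, hrun, hle, hdeg, hcard⟩ := ih
    refine ⟨fun v => if h v = j ∧ thr < {u | (classGraph G z).Adj v u ∧ h u = j}.ncard
        then j + 1 else h v, ?_, ?_, ?_, ?_⟩
    · rw [levelProg, run_append, hrun]
      exact round_levelStep G thr j i z h d c l
    · intro v
      have := hle v
      dsimp only
      split_ifs <;> omega
    · intro v hv
      beta_reduce at hv
      have hsub : {u | (classGraph G z).Adj v u ∧
          (if h v = j ∧ thr < {u | (classGraph G z).Adj v u ∧ h u = j}.ncard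
            then j + 1 else h v) ≤
          (if h u = j ∧ thr < {w | (classGraph G z).Adj u w ∧ h w = j}.ncard
            then j + 1 else h u)} ⊆ {u | (classGraph G z).Adj v u ∧ h v ≤ h u} := by
        rintro u ⟨hu, hu'⟩
        refine ⟨hu, ?_⟩
        have := hle v
        split_ifs at hu' hv <;> omega
      refine (Set.ncard_le_ncard hsub (Set.toFinite _)).trans ?_
      by_cases hvj : h v < j
      · exact hdeg v hvj
      · have hvj' : h v = j := le_antisymm (hle v) (not_lt.1 hvj)
        have hn : ¬ thr < {u | (classGraph G z).Adj v u ∧ h u = j}.ncard := by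
          intro hlt
          rw [if_pos ⟨hvj', hlt⟩] at hv
          omega
        refine le_trans (Set.ncard_le_ncard ?_ (Set.toFinite _)) (not_lt.1 hn)
        rintro u ⟨hu, hu'⟩
        exact ⟨hu, le_antisymm (hle u) (hvj' ▸ hu')⟩
    -- The vertices that move up are those of high degree inside level `j`.
    · have hstep := hG.card_filter_le hα hε {v | h v = j}
        {v | h v = j ∧ thr < {u | (classGraph G z).Adj v u ∧ h u = j}.ncard}
        (fun v hv => by simp at hv ⊢; exact hv.1)
        (fun v hv => by simpa using (Finset.mem_filter.1 hv).2.2)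
      have hset : ∀ v, (if h v = j ∧ thr < {u | (classGraph G z).Adj v u ∧ h u = j}.ncard
            then j + 1 else h v) = j + 1 ↔
          h v = j ∧ thr < {u | (classGraph G z).Adj v u ∧ h u = j}.ncard := by
        intro v
        have := hle v
        refine ⟨fun hv => ?_, fun hv => if_pos hv⟩
        by_contra hn
        rw [if_neg hn] at hv
        omega
      simp only [hset]
      rw [pow_succ, mul_assoc]
      exact le_trans (by gcongr) hcard

/-! ### Defective coloring of the `H`-sets -/

/-- Recoloring with `q ^ 2` colors: a vertex with the color `c` picks a place `x` at which the
function of index `c` agrees with those of as few neighbors in its `H`-set as possible. -/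
noncomputable def shadeStep (q : ℕ) : Step := fun s ms =>
  let x := pick q fun x => tally s (fun u => u.level = s.level ∧ u.shade ≠ s.shade ∧
    spreadFamily q u.shade x = spreadFamily q s.shade x) ms
  { s with shade := x * q + spreadFamily q s.shade x }

/-- Recolorings with `q = q₀ ^ 2 ^ (j - 1), …, q₀ ^ 4, q₀ ^ 2, q₀`. -/
noncomputable def shadeProg (q₀ : ℕ) : ℕ → List Step
  | 0 => []
  | j + 1 => shadeStep (q₀ ^ 2 ^ j) :: shadeProg q₀ j

theorem length_shadeProg (q₀ j : ℕ) : (shadeProg q₀ j).length = j := by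
  induction j with
  | zero => rfl
  | succ j ih => simp [shadeProg, ih]

/-- The effect of `shadeStep` on the colors `d`, for the `H`-index `h`. -/
noncomputable def reshade (G : SimpleGraph V) (q : ℕ) (h d : V → ℕ) (v : V) : ℕ :=
  let x := pick q fun x => {u | G.Adj v u ∧ h u = h v ∧ d u ≠ d v ∧
    spreadFamily q (d u) x = spreadFamily q (d v) x}.ncard
  x * q + spreadFamily q (d v) x

theorem round_shadeStep (G : SimpleGraph V) (q : ℕ) (i z h d c : V → ℕ) (l : V → VertexLog) :
    round G (shadeStep q) (pack i z h d c l) =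
      pack i z h (reshade (classGraph G z) q h d) c l := by
  funext v
  simp only [round, shadeStep, tally_pack]
  rfl

theorem reshade_lt {V : Type*} (G : SimpleGraph V) {q : ℕ} (hq : 0 < q)
    (hf : IsSpread q (spreadFamily q)) (h d : V → ℕ) (v : V) : reshade G q h d v < q ^ 2 := by
  rw [reshade]
  have h1 := (pick_spec hq fun x => {u | G.Adj v u ∧ h u = h v ∧ d u ≠ d v ∧
    spreadFamily q (d u) x = spreadFamily q (d v) x}.ncard).1
  set x := pick q fun x => {u | G.Adj v u ∧ h u = h v ∧ d u ≠ d v ∧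
    spreadFamily q (d u) x = spreadFamily q (d v) x}.ncard
  have h2 := hf.1 (d v) x
  calc x * q + spreadFamily q (d v) x < x * q + q := by omega
    _ = (x + 1) * q := by ring
    _ ≤ q * q := by gcongr; exact h1
    _ = q ^ 2 := by ring

/-- Recoloring increases the defect by at most `3 D / q`. -/
theorem ncard_reshade_le (G : SimpleGraph V) {q : ℕ} (hq : 0 < q)
    (hf : IsSpread q (spreadFamily q)) {h d : V → ℕ} (hd : ∀ v, d v < q ^ 4) {D : ℕ} {v : V}
    (hD : {u | G.Adj v u ∧ h u = h v}.ncard ≤ D) :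
    ({u | G.Adj v u ∧ h u = h v ∧ reshade G q h d u = reshade G q h d v}.ncard : ℝ) ≤
      ({u | G.Adj v u ∧ h u = h v ∧ d u = d v}.ncard : ℝ) + 3 * D / q := by
  classical
  let w : V → ℕ → ℕ := fun v x => {u | G.Adj v u ∧ h u = h v ∧ d u ≠ d v ∧
    spreadFamily q (d u) x = spreadFamily q (d v) x}.ncard
  have hre : ∀ u, reshade G q h d u =
      pick q (w u) * q + spreadFamily q (d u) (pick q (w u)) := fun _ => rfl
  have hdiv : ∀ u, reshade G q h d u / q = pick q (w u) := by
    intro u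
    rw [hre, mul_comm, Nat.mul_add_div hq, Nat.div_eq_of_lt (hf.1 _ _), add_zero]
  -- Equal new colors encode the same place and the same value there. So a conflicting neighbor
  -- either conflicted before or agrees with `v` at the place picked by `v`.
  have hsub : {u | G.Adj v u ∧ h u = h v ∧ reshade G q h d u = reshade G q h d v} ⊆
      {u | G.Adj v u ∧ h u = h v ∧ d u = d v} ∪ {u | G.Adj v u ∧ h u = h v ∧ d u ≠ d v ∧
        spreadFamily q (d u) (pick q (w v)) = spreadFamily q (d v) (pick q (w v))} := by
    rintro u ⟨hu, hhu, heq⟩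
    by_cases hduv : d u = d v
    · exact Or.inl ⟨hu, hhu, hduv⟩
    · refine Or.inr ⟨hu, hhu, hduv, ?_⟩
      have hx : pick q (w u) = pick q (w v) := by rw [← hdiv u, ← hdiv v, heq]
      rw [hre, hre, hx] at heq
      exact Nat.add_left_cancel heq
  -- The minimum over the `q` places is at most the average, and each neighbor contributes at most
  -- three agreements in total.
  have hmin : q * w v (pick q (w v)) ≤ 3 * D := by
    let N : Finset V := {u | G.Adj v u ∧ h u = h v ∧ d u ≠ d v}
    have hw : ∀ x, w v x =
        (N.filter fun u => spreadFamily q (d u) x = spreadFamily q (d v) x).card := by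
      intro x
      rw [← Set.ncard_coe_finset]
      show Set.ncard _ = Set.ncard _
      congr 1
      ext u
      simp [N, and_assoc]
    have hN : N.card ≤ D := by
      refine le_trans ?_ hD
      rw [← Set.ncard_coe_finset]
      refine Set.ncard_le_ncard (fun u hu => ?_) (Set.toFinite _)
      have := (Finset.mem_filter.1 (Finset.mem_coe.1 hu)).2
      exact ⟨this.1, this.2.1⟩
    calc q * w v (pick q (w v)) = ∑ x ∈ Finset.range q, w v (pick q (w v)) := by simp
      _ ≤ ∑ x ∈ Finset.range q, w v x :=
          Finset.sum_le_sum fun x hx => (pick_spec hq (w v)).2 x (Finset.mem_range.1 hx)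
      _ = ∑ u ∈ N, {x ∈ Finset.range q |
            spreadFamily q (d u) x = spreadFamily q (d v) x}.card := by
          simp only [hw]
          exact (Finset.sum_card_bipartiteAbove_eq_sum_card_bipartiteBelow
            (fun (u : V) (x : ℕ) => spreadFamily q (d u) x = spreadFamily q (d v) x)).symm
      _ ≤ ∑ u ∈ N, 3 := Finset.sum_le_sum fun u hu =>
          hf.2 _ (hd u) _ (hd v) (Finset.mem_filter.1 hu).2.2.2
      _ = 3 * N.card := by simp [mul_comm]
      _ ≤ 3 * D := by gcongr
  have h1 := (Set.ncard_le_ncard hsub (Set.toFinite _)).trans (Set.ncard_union_le _ _)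
  have hq' : (0 : ℝ) < q := by exact_mod_cast hq
  have h2 : (w v (pick q (w v)) : ℝ) ≤ 3 * D / q := by
    rw [le_div_iff₀ hq', mul_comm]
    exact_mod_cast hmin
  calc _ ≤ ({u | G.Adj v u ∧ h u = h v ∧ d u = d v}.ncard : ℝ) + w v (pick q (w v)) := by
        exact_mod_cast h1
    _ ≤ _ := by gcongr

/-- A recoloring with parameter `Q` takes `Q ^ 4` colors to `Q ^ 2`, and `Q` is the square of the
next parameter, so successive recolorings fit together. The added defects `3 D / Q` accumulate. -/
theorem run_shadeProg (G : SimpleGraph V) (i z h c : V → ℕ) (l : V → VertexLog) {b : ℕ}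
    (hb : b ≠ 0) {D : ℕ} (hD : ∀ v, {u | (classGraph G z).Adj v u ∧ h u = h v}.ncard ≤ D)
    (j : ℕ) (d : V → ℕ) (hd : ∀ v, d v < (2 ^ b) ^ 2 ^ (j + 1)) :
    ∃ d' : V → ℕ, run G (shadeProg (2 ^ b) j) (pack i z h d c l) = pack i z h d' c l ∧
      (∀ v, d' v < (2 ^ b) ^ 2) ∧
      ∀ v, ({u | (classGraph G z).Adj v u ∧ h u = h v ∧ d' u = d' v}.ncard : ℝ) ≤
        ({u | (classGraph G z).Adj v u ∧ h u = h v ∧ d u = d v}.ncard : ℝ) +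
          ∑ m ∈ Finset.range j, 3 * (D : ℝ) / ((2 ^ b : ℕ) : ℝ) ^ 2 ^ m := by
  induction j generalizing d with
  | zero => exact ⟨d, rfl, by simpa using hd, by simp⟩
  | succ j ih =>
    have hf : IsSpread ((2 ^ b) ^ 2 ^ j) (spreadFamily ((2 ^ b) ^ 2 ^ j)) := by
      rw [← pow_mul]
      exact isSpread_spreadFamily (by positivity)
    have hq : 0 < (2 ^ b) ^ 2 ^ j := by positivity
    obtain ⟨d', hrun, hlt, hdef⟩ := ih (reshade (classGraph G z) ((2 ^ b) ^ 2 ^ j) h d) fun v => by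
      refine (reshade_lt _ hq hf h d v).trans_eq ?_
      rw [← pow_mul, pow_succ]
    refine ⟨d', ?_, hlt, fun v => (hdef v).trans ?_⟩
    · rw [shadeProg, run, round_shadeStep, hrun]
    · have := ncard_reshade_le (classGraph G z) hq hf (h := h) (d := d) (v := v) (fun v => by
        refine (hd v).trans_eq ?_
        rw [← pow_mul (2 ^ b), show 2 ^ (j + 1 + 1) = 2 ^ j * 4 by ring]) (hD v)
      rw [Finset.sum_range_succ]
      push_cast at this ⊢
      linarith

/-- Since `q ^ 2 ^ m ≥ q * 2 ^ m`, a geometric series dominates: the total defect does not depend on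
the number of recolorings. -/
theorem sum_div_pow_two_pow_le {q : ℝ} (hq : 2 ≤ q) {x : ℝ} (hx : 0 ≤ x) (j : ℕ) :
    ∑ m ∈ Finset.range j, x / q ^ 2 ^ m ≤ 2 * x / q := by
  have hterm : ∀ m : ℕ, x / q ^ 2 ^ m ≤ x / q * (1 / 2) ^ m := by
    intro m
    have h1 : q * 2 ^ m ≤ q ^ 2 ^ m := by
      calc q * 2 ^ m ≤ q * q ^ m := by gcongr
        _ = q ^ (m + 1) := by ring
        _ ≤ q ^ 2 ^ m := pow_le_pow_right₀ (by linarith) Nat.lt_two_pow_self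
    calc x / q ^ 2 ^ m ≤ x / (q * 2 ^ m) := by gcongr
      _ = _ := by rw [one_div, inv_pow, div_mul_eq_div_div, div_eq_mul_inv (x / q)]
  calc _ ≤ ∑ m ∈ Finset.range j, x / q * (1 / 2) ^ m := Finset.sum_le_sum fun m _ => hterm m
    _ = x / q * ∑ m ∈ Finset.range j, (1 / 2 : ℝ) ^ m := by rw [Finset.mul_sum]
    _ ≤ x / q * 2 := by gcongr; exact sum_geometric_two_le j
    _ = _ := by ring

/-! ### Selecting the colors -/

/-- The vertices whose place `level * Q + shade` in the order is `κ` select a color among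
`0, …, k - 1` that is used least by their neighbors with greater places. -/
noncomputable def classStep (k Q κ : ℕ) : Step := fun s ms =>
  if s.level * Q + s.shade = κ then
    { s with cls := pick k fun j =>
        tally s (fun u => κ < u.level * Q + u.shade ∧ u.cls = j) ms }
  else s

/-- The vertices of places `N - 1, …, 1, 0` select their colors in this order. -/
noncomputable def classProg (k Q : ℕ) : ℕ → List Step
  | 0 => []
  | N + 1 => classStep k Q N :: classProg k Q N

theorem length_classProg (k Q N : ℕ) : (classProg k Q N).length = N := by
  induction N with
  | zero => rfl
  | succ N ih => simp [classProg, ih]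

theorem round_classStep (G : SimpleGraph V) (k Q κ : ℕ) (i z h d c : V → ℕ)
    (l : V → VertexLog) :
    round G (classStep k Q κ) (pack i z h d c l) =
      pack i z h d (fun v => if h v * Q + d v = κ then pick k fun j =>
        {u | (classGraph G z).Adj v u ∧ κ < h u * Q + d u ∧ c u = j}.ncard else c v) l := by
  funext v
  simp only [round, classStep, tally_pack]
  by_cases hv : h v * Q + d v = κ
  · exact (if_pos hv).trans (by simp only [pack, if_pos hv])
  · exact (if_neg hv).trans (by simp only [pack, if_neg hv])

/-- When a vertex selects, all vertices of greater place have already done so and never change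
again. Hence its choice is minimal with respect to the final colors `c'`. -/
theorem run_classProg (G : SimpleGraph V) (k Q : ℕ) (i z h d : V → ℕ) (l : V → VertexLog)
    (N : ℕ) (c : V → ℕ) :
    ∃ c' : V → ℕ, run G (classProg k Q N) (pack i z h d c l) = pack i z h d c' l ∧
      (∀ v, N ≤ h v * Q + d v → c' v = c v) ∧
      ∀ v, h v * Q + d v < N → c' v = pick k fun j =>
        {u | (classGraph G z).Adj v u ∧ h v * Q + d v < h u * Q + d u ∧ c' u = j}.ncard := by
  induction N generalizing c with
  | zero => exact ⟨c, rfl, fun _ _ => rfl, fun v hv => absurd hv (by omega)⟩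
  | succ N ih =>
    obtain ⟨c', hrun, hge, hlt⟩ := ih fun v => if h v * Q + d v = N then pick k fun j =>
        {u | (classGraph G z).Adj v u ∧ N < h u * Q + d u ∧ c u = j}.ncard else c v
    have hge' : ∀ v, N < h v * Q + d v → c' v = c v := by
      intro v hv
      rw [hge v hv.le, if_neg (by omega)]
    refine ⟨c', ?_, fun v hv => hge' v hv, fun v hv => ?_⟩
    · rw [classProg, run, round_classStep, hrun]
    · rcases (Nat.lt_succ_iff.1 hv).lt_or_eq with hv' | hv'
      · exact hlt v hv'
      · rw [hge v hv'.ge, if_pos hv']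
        congr 1
        funext j
        congr 1
        ext u
        constructor
        · rintro ⟨h1, h2, h3⟩
          exact ⟨h1, hv' ▸ h2, (hge' u h2).trans h3⟩
        · rintro ⟨h1, h2, h3⟩
          rw [hv'] at h2
          exact ⟨h1, h2, (hge' u h2).symm.trans h3⟩

end Run


section Execution

variable {V : Type*} [Fintype V]

/-! ### Arbdefective-Coloring -/

/-- A vertex prepares for the next invocation of Arbdefective-Coloring. -/
def resetStep : Step := fun s _ => { s with level := 0, shade := s.ident - 1 }

/-- Arbdefective-Coloring with `k` colors: an `H`-partition of degree `thr` into `ℓ` sets, a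
defective coloring with `q₀ ^ 2` colors by `J` recolorings, and the selection of the colors. -/
noncomputable def arbProg (thr k q₀ ℓ J : ℕ) : List Step :=
  resetStep :: (levelProg thr ℓ ++ (shadeProg q₀ J ++ classProg k (q₀ ^ 2) (ℓ * q₀ ^ 2)))

theorem length_arbProg (thr k q₀ ℓ J : ℕ) :
    (arbProg thr k q₀ ℓ J).length = ℓ * (q₀ ^ 2 + 1) + J + 1 := by
  simp only [arbProg, List.length_cons, List.length_append, length_levelProg, length_shadeProg,
    length_classProg]
  ring

/-- As `d < Q`, the number `H * Q + d` encodes the lexicographic order, so parents are the neighbors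
of greater place. -/
theorem mem_parents_iff {V : Type*} {G : SimpleGraph V} {H d : V → ℕ} {Q : ℕ}
    (hd : ∀ v, d v < Q) (v u : V) :
    u ∈ parents G H d v ↔ G.Adj v u ∧ H v * Q + d v < H u * Q + d u := by
  have key : ∀ v u, H v < H u → H v * Q + d v < H u * Q + d u := by
    intro v u h
    calc H v * Q + d v < H v * Q + Q := by have := hd v; omega
      _ = (H v + 1) * Q := by ring
      _ ≤ H u * Q := Nat.mul_le_mul_right _ h
      _ ≤ _ := Nat.le_add_right _ _
  refine and_congr_right fun _ => ⟨?_, fun h => ?_⟩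
  · rintro (h | ⟨h, h'⟩)
    · exact key v u h
    · rw [h]; omega
  · rcases lt_trichotomy (H v) (H u) with h' | h' | h'
    · exact Or.inl h'
    · rw [h'] at h; exact Or.inr ⟨h', by omega⟩
    · exact absurd (key u v h') (by omega)

theorem run_arbProg {ε C : ℝ} (hε : 0 < ε) (hε1 : ε < 1) (hC : 1024 ≤ C) {ℓ : ℕ}
    (hℓ : (Fintype.card V : ℝ) < (1 + ε / 2) ^ ℓ)
    (hℓC : (ℓ : ℝ) ≤ C * Real.logb 2 (Fintype.card V)) {G : SimpleGraph V} {i : V → ℕ}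
    (hi : IsIdentity i) (z h₀ d₀ c₀ : V → ℕ) (l : V → VertexLog) {α : ℕ} (hα : 0 < α)
    (hG : IsSparse (classGraph G z) α) {k : ℕ} (hk : 0 < k) {t b : ℕ} (hb : b ≠ 0)
    (htb : 2 ^ b = 32 * t) :
    ∃ h d c : V → ℕ,
      run G (arbProg ⌊(2 + ε) * (α : ℝ)⌋₊ k (32 * t) ℓ (Nat.log 2 (Fintype.card V)))
        (pack i z h₀ d₀ c₀ l) = pack i z h d c l ∧
      IsArbdefectiveColoring ε C (classGraph G z) α k t h d c := by
  classical
  set thr := ⌊(2 + ε) * (α : ℝ)⌋₊ with hthr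
  set J := Nat.log 2 (Fintype.card V) with hJ
  obtain ⟨h, hrun, hle, hdeg, hcard⟩ := run_levelProg G i z (fun v => i v - 1) c₀ l hG hα hε ℓ
  -- Fewer than one vertex can remain at level `ℓ`, so every vertex is settled.
  have hlt : ∀ v, h v < ℓ := by
    intro v
    refine lt_of_le_of_ne (hle v) fun hv => ?_
    have h1 : (1 : ℝ) ≤ (Finset.card {v | h v = ℓ} : ℝ) := by
      exact_mod_cast Finset.card_pos.2 ⟨v, by simpa using hv⟩
    have h2 : (0 : ℝ) < (1 + ε / 2) ^ ℓ := by positivity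
    nlinarith
  have hD : ∀ v, {u | (classGraph G z).Adj v u ∧ h u = h v}.ncard ≤ thr := by
    intro v
    refine (Set.ncard_le_ncard ?_ (Set.toFinite _)).trans (hdeg v (hlt v))
    rintro u ⟨hu, hu'⟩
    exact ⟨hu, hu'.ge⟩
  -- With `J = ⌊log n⌋` recolorings, many more than the doubly exponential growth requires, the
  -- identity numbers clearly fit the initial range; the rounds spent are still `O(log n)`.
  have hshade : ∀ v, i v - 1 < (2 ^ b) ^ 2 ^ (J + 1) := by
    intro v
    have h1 := hi.2 v
    calc i v - 1 < Fintype.card V := by omega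
      _ < 2 ^ (J + 1) := Nat.lt_pow_succ_log_self one_lt_two _
      _ ≤ 2 ^ 2 ^ (J + 1) := Nat.pow_le_pow_right two_pos Nat.lt_two_pow_self.le
      _ ≤ (2 ^ b) ^ 2 ^ (J + 1) := Nat.pow_le_pow_left (Nat.le_self_pow hb 2) _
  obtain ⟨d, hrund, hdlt, hdef⟩ := run_shadeProg G i z h c₀ l hb hD J (fun v => i v - 1) hshade
  rw [htb] at hrund hdlt hdef
  have ht : 0 < t := by
    have : 0 < 2 ^ b := by positivity
    omega
  obtain ⟨c, hrunc, -, hcsel⟩ :=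
    run_classProg G k ((32 * t) ^ 2) i z h d l (ℓ * (32 * t) ^ 2) c₀
  refine ⟨h, d, c, ?_, ⟨?_, fun v => hdeg v (hlt v)⟩, ⟨?_, ?_⟩, ?_⟩
  · have hreset : round G resetStep (pack i z h₀ d₀ c₀ l) =
        pack i z 0 (fun v => i v - 1) c₀ l := rfl
    rw [arbProg, run, hreset, run_append, run_append, hrun, hrund, hrunc]
  · intro v
    refine le_trans ?_ hℓC
    exact_mod_cast hlt v
  · intro v
    calc (d v : ℝ) + 1 ≤ ((32 * t : ℕ) : ℝ) ^ 2 := by exact_mod_cast hdlt v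
      _ = 1024 * (t : ℝ) ^ 2 := by push_cast; ring
      _ ≤ _ := by gcongr
  · intro v
    -- The initial colors are the identity numbers shifted to start at `0`. They are distinct, so
    -- the initial defect vanishes.
    have hzero : {u | (classGraph G z).Adj v u ∧ h u = h v ∧ i u - 1 = i v - 1}.ncard = 0 := by
      rw [Set.ncard_eq_zero (Set.toFinite _), Set.eq_empty_iff_forall_notMem]
      rintro u ⟨hu, -, hiu⟩
      have h1 := hi.2 u
      have h2 := hi.2 v
      exact hu.ne (hi.1 (by omega : i v = i u))
    have h1 := hdef v
    rw [hzero] at h1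
    have htr : (1 : ℝ) ≤ t := by exact_mod_cast ht
    have h2 := sum_div_pow_two_pow_le (q := ((32 * t : ℕ) : ℝ)) (by push_cast; linarith)
      (x := 3 * (thr : ℝ)) (by positivity) J
    have h3 : (thr : ℝ) ≤ 3 * α := by
      refine (Nat.floor_le (by positivity)).trans ?_
      gcongr
      linarith
    rw [Nat.le_div_iff_mul_le ht]
    have h4 : ({u | (classGraph G z).Adj v u ∧ h u = h v ∧ d u = d v}.ncard : ℝ) * t ≤ α := by
      -- The defect is at most `2 * 3 * 3 α / (32 t) = 18 α / (32 t)`; this is why `q₀ = 32 t`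
      -- suffices.
      have h5 : 2 * (3 * (thr : ℝ)) / ((32 * t : ℕ) : ℝ) ≤ α / t := by
        push_cast
        rw [div_le_div_iff₀ (by positivity) (by positivity)]
        nlinarith
      rw [← le_div_iff₀ (by positivity)]
      push_cast at h1 h2 h5 ⊢
      linarith
    exact_mod_cast h4
  · intro v
    have hkey : h v * (32 * t) ^ 2 + d v < ℓ * (32 * t) ^ 2 := by
      calc h v * (32 * t) ^ 2 + d v < h v * (32 * t) ^ 2 + (32 * t) ^ 2 := by
            have := hdlt v; omega
        _ = (h v + 1) * (32 * t) ^ 2 := by ring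
        _ ≤ _ := Nat.mul_le_mul_right _ (hlt v)
    have hsel := pick_spec hk fun j => {u | (classGraph G z).Adj v u ∧
      h v * (32 * t) ^ 2 + d v < h u * (32 * t) ^ 2 + d u ∧ c u = j}.ncard
    rw [← hcsel v hkey] at hsel
    simpa only [mem_parents_iff hdlt, and_assoc] using hsel

/-! ### Legal-Coloring -/

/-- A vertex records the results of iteration `m` and computes the index of its new subgraph. -/
noncomputable def recordStep (p m : ℕ) : Step := fun s _ =>
  { s with
    part := s.part * p + s.cls
    log := { s.log with
      hIndex := Function.update s.log.hIndex m s.level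
      defColor := Function.update s.log.defColor m s.shade
      arbColor := Function.update s.log.arbColor m s.cls } }

/-- A vertex computes its final color. -/
def finishStep (A : ℕ) : Step := fun s _ =>
  { s with log := { s.log with localColor := s.cls, color := s.part * A + s.cls } }

/-- The first `m` iterations of the while-loop. -/
noncomputable def loopProg (ε : ℝ) (p a ℓ J : ℕ) : ℕ → List Step
  | 0 => []
  | m + 1 => loopProg ε p a ℓ J m ++
      (arbProg ⌊(2 + ε) * (arbBound ε p a m : ℝ)⌋₊ p (32 * p) ℓ J ++ [recordStep p m])

/-- Legal-Coloring, with `r` iterations of the while-loop. The final subgraphs are colored by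
Arbdefective-Coloring with so many colors that the result is legal. -/
noncomputable def legalProg (ε : ℝ) (p a ℓ J r : ℕ) : List Step :=
  loopProg ε p a ℓ J r ++
    (arbProg ⌊(2 + ε) * (arbBound ε p a r : ℝ)⌋₊ (⌊(2 + ε) * (arbBound ε p a r : ℝ)⌋₊ + 1)
      (32 * (2 * p)) ℓ J ++ [finishStep (⌊(2 + ε) * (arbBound ε p a r : ℝ)⌋₊ + 1)])

theorem length_loopProg (ε : ℝ) (p a ℓ J m : ℕ) :
    (loopProg ε p a ℓ J m).length = m * (ℓ * ((32 * p) ^ 2 + 1) + J + 2) := by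
  induction m with
  | zero => simp [loopProg]
  | succ m ih =>
    simp only [loopProg, List.length_append, ih, length_arbProg, List.length_singleton]
    ring

theorem length_legalProg_le (ε : ℝ) (p a ℓ J r : ℕ) :
    (legalProg ε p a ℓ J r).length ≤ (r + 1) * (ℓ * ((64 * p) ^ 2 + 1) + J + 2) := by
  simp only [legalProg, List.length_append, length_loopProg, length_arbProg,
    List.length_singleton]
  calc r * (ℓ * ((32 * p) ^ 2 + 1) + J + 2) + (ℓ * ((32 * (2 * p)) ^ 2 + 1) + J + 1 + 1)
      ≤ r * (ℓ * ((64 * p) ^ 2 + 1) + J + 2) + (ℓ * ((32 * (2 * p)) ^ 2 + 1) + J + 1 + 1) := by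
        gcongr; norm_num
    _ = _ := by ring

theorem subgraphIndex_congr {V : Type*} (p : ℕ) {L L' : V → VertexLog} {m : ℕ}
    (h : ∀ j < m, ∀ v, (L v).arbColor j = (L' v).arbColor j) :
    subgraphIndex p L m = subgraphIndex p L' m := by
  induction m with
  | zero => rfl
  | succ m ih =>
    funext v
    rw [subgraphIndex, subgraphIndex, ih fun j hj => h j (by omega), h m (by omega)]

/-- Splitting along the colors `c` all the subgraphs of indices `z`. -/
theorem classGraph_mul_add {V : Type*} (G : SimpleGraph V) {z c : V → ℕ} {p : ℕ}
    (hc : ∀ v, c v < p) :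
    classGraph G (fun v => z v * p + c v) = classGraph (classGraph G z) c := by
  ext u v
  have hp : 0 < p := (Nat.zero_le _).trans_lt (hc u)
  simp only [classGraph, and_assoc]
  refine and_congr_right fun _ => ⟨fun h => ?_, fun ⟨h, h'⟩ => by rw [h, h']⟩
  have hdiv : ∀ w, (z w * p + c w) / p = z w := fun w => by
    rw [mul_comm, Nat.mul_add_div hp, Nat.div_eq_of_lt (hc w), add_zero]
  have hz : z u = z v := by rw [← hdiv u, ← hdiv v, h]
  rw [hz] at h
  exact ⟨hz, Nat.add_left_cancel h⟩

/-- Sparsity is the loop invariant: it is what `run_arbProg` needs, and the coloring computed there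
passes it on to the new subgraphs. -/
theorem run_loopProg {ε C : ℝ} (hε : 0 < ε) (hε1 : ε < 1) (hC : 1024 ≤ C) {ℓ : ℕ}
    (hℓ : (Fintype.card V : ℝ) < (1 + ε / 2) ^ ℓ)
    (hℓC : (ℓ : ℝ) ≤ C * Real.logb 2 (Fintype.card V)) {G : SimpleGraph V} {i : V → ℕ}
    (hi : IsIdentity i) {a : ℕ} (hG : IsSparse G a) {p b : ℕ} (hpb : p = 2 ^ b) (m : ℕ)
    (hm : ∀ j < m, p < arbBound ε p a j) :
    ∃ (z h d c : V → ℕ) (l : V → VertexLog),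
      run G (loopProg ε p a ℓ (Nat.log 2 (Fintype.card V)) m) (fun v => initialState (i v)) =
        pack i z h d c l ∧
      z = subgraphIndex p l m ∧ IsSparse (classGraph G z) (arbBound ε p a m) ∧
      ∀ j < m, IsArbdefectiveColoring ε C (classGraph G (subgraphIndex p l j))
        (arbBound ε p a j) p p (fun v => (l v).hIndex j) (fun v => (l v).defColor j)
        (fun v => (l v).arbColor j) := by
  have hp : 0 < p := by rw [hpb]; positivity
  induction m with
  | zero =>
    refine ⟨0, 0, 0, 0, fun _ => ⟨0, 0, 0, 0, 0⟩, rfl, rfl, ?_, by simp⟩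
    have : classGraph G (0 : V → ℕ) = G := by ext; simp [classGraph]
    rw [this]
    exact hG
  | succ m ih =>
    obtain ⟨z, h, d, c, l, hrun, hz, hsp, hprev⟩ := ih fun j hj => hm j (by omega)
    have hαp := hm m (by omega)
    obtain ⟨h', d', c', hrun', harb⟩ := run_arbProg hε hε1 hC hℓ hℓC hi z h d c l
      (by omega : 0 < arbBound ε p a m) hsp hp (t := p) (b := b + 5) (by omega)
      (by rw [hpb, pow_add]; ring)
    let l' : V → VertexLog := fun v => { l v with
      hIndex := Function.update (l v).hIndex m (h' v)
      defColor := Function.update (l v).defColor m (d' v)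
      arbColor := Function.update (l v).arbColor m (c' v) }
    -- Recording iteration `m` changes no earlier log entry, so the subgraphs of earlier iterations
    -- remain the same.
    have hidx : ∀ j ≤ m, subgraphIndex p l' j = subgraphIndex p l j := fun j hj =>
      subgraphIndex_congr p fun k hk v => Function.update_of_ne (by omega) _ _
    have hcol : ∀ v, (l' v).arbColor m = c' v := fun v => Function.update_self _ _ _
    refine ⟨fun v => z v * p + c' v, h', d', c', l', ?_, ?_, ?_, fun j hj => ?_⟩
    · rw [loopProg, run_append, hrun, run_append, hrun']
      rfl
    · funext v
      rw [subgraphIndex, hidx m le_rfl, hcol, hz]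
    · rw [classGraph_mul_add G fun v => (harb.2.2 v).1]
      exact harb.isSparse hε hp
    · rcases (Nat.lt_succ_iff.1 hj).lt_or_eq with hj' | rfl
      · have hne : j ≠ m := hj'.ne
        rw [hidx j hj'.le]
        simpa only [l', Function.update_of_ne hne] using hprev j hj'
      · rw [hidx j le_rfl, ← hz]
        simpa only [l', Function.update_self] using harb

theorem run_legalProg {ε C : ℝ} (hε : 0 < ε) (hε1 : ε < 1) (hC : 1024 ≤ C) {ℓ : ℕ}
    (hℓ : (Fintype.card V : ℝ) < (1 + ε / 2) ^ ℓ)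
    (hℓC : (ℓ : ℝ) ≤ C * Real.logb 2 (Fintype.card V)) {G : SimpleGraph V} {i : V → ℕ}
    (hi : IsIdentity i) {a : ℕ} (hG : IsSparse G a) {p b : ℕ} (hpb : p = 2 ^ b) {r : ℕ}
    (hr : ∀ j < r, p < arbBound ε p a j) (hr' : arbBound ε p a r ≤ p)
    (hpos : 0 < arbBound ε p a r) :
    IsLegalColoringExecution ε C p a G fun v =>
      (run G (legalProg ε p a ℓ (Nat.log 2 (Fintype.card V)) r)
        (fun v => initialState (i v)) v).log := by
  obtain ⟨z, h, d, c, l, hrun, hz, hsp, hprev⟩ := run_loopProg hε hε1 hC hℓ hℓC hi hG hpb r hr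
  have hp : 0 < p := by rw [hpb]; positivity
  set A := ⌊(2 + ε) * (arbBound ε p a r : ℝ)⌋₊ + 1 with hA
  -- Since `α ≤ p < 2 p`, the choice `t = 2 p` leaves no defect, and `32 t = 2 ^ (b + 6)` is still a
  -- power of two.
  obtain ⟨h', d', c', hrun', harb⟩ := run_arbProg hε hε1 hC hℓ hℓC hi z h d c l hpos hsp
    (k := A) (by omega) (t := 2 * p) (b := b + 6) (by omega) (by rw [hpb, pow_add]; ring)
  have hfinal : run G (legalProg ε p a ℓ (Nat.log 2 (Fintype.card V)) r)
      (fun v => initialState (i v)) = pack i z h' d' c'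
        fun v => { l v with localColor := c' v, color := z v * A + c' v } := by
    rw [legalProg, run_append, hrun, run_append, hrun']
    rfl
  have hidx : ∀ j, subgraphIndex p (fun v => { l v with
      localColor := c' v, color := z v * A + c' v }) j = subgraphIndex p l j := fun j =>
    subgraphIndex_congr p fun _ _ _ => rfl
  rw [hfinal]
  refine ⟨r, fun j hj => ⟨hr j hj, ?_⟩, hr', ?_, fun v => ?_⟩
  · simp only [pack]
    rw [hidx]
    exact hprev j hj
  · simp only [pack]
    rw [hidx, ← hz]
    exact harb.isLegalColoring (by omega)
  · simp only [pack]
    rw [hidx, ← hz]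

end Execution

/-! ### Parameters -/

/-- The number of iterations of the while-loop. -/
noncomputable def numIter (ε : ℝ) (p a : ℕ) : ℕ := sInf {r | arbBound ε p a r ≤ p}

theorem arbBound_numIter_le {ε : ℝ} (hε : 0 < ε) (hε1 : ε < 1) {p : ℕ} (hp : 16 ≤ p) (a : ℕ) :
    arbBound ε p a (numIter ε p a) ≤ p := by
  -- Already `a` iterations suffice: `a < 2 ^ a ≤ (p / 4) ^ a` forces the bound down to `0`.
  refine Nat.sInf_mem (s := {r | arbBound ε p a r ≤ p}) ⟨a, ?_⟩
  have hp' : (16 : ℝ) ≤ p := by exact_mod_cast hp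
  have h := pow_mul_arbBound_le hε hε1 (by omega : 0 < p) a a
  have h1 : (a : ℝ) < ((p : ℝ) / 4) ^ a := by
    calc (a : ℝ) < 2 ^ a := by exact_mod_cast Nat.lt_two_pow_self
      _ ≤ _ := by gcongr; linarith
  by_contra hlt
  have h2 : (1 : ℝ) ≤ arbBound ε p a a := by
    exact_mod_cast (by simp only [Set.mem_ofPred_eq] at hlt; omega : 1 ≤ arbBound ε p a a)
  have h3 : (0 : ℝ) < ((p : ℝ) / 4) ^ a := by positivity
  nlinarith

theorem lt_arbBound_of_lt_numIter {ε : ℝ} {p a i : ℕ} (hi : i < numIter ε p a) :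
    p < arbBound ε p a i :=
  not_le.1 (Nat.notMem_of_lt_sInf (s := {r | arbBound ε p a r ≤ p}) hi)

/-- The bound before the last iteration exceeds `p`, so its quotient by `p` survives the floor.
Positivity is needed for the peeling argument. -/
theorem arbBound_numIter_pos {ε : ℝ} (hε : 0 < ε) {p a : ℕ} (hp : 0 < p) (ha : 0 < a) :
    0 < arbBound ε p a (numIter ε p a) := by
  rcases h : numIter ε p a with _ | m
  · exact ha
  · have h1 := lt_arbBound_of_lt_numIter (ε := ε) (p := p) (a := a) (i := m) (by omega)
    have hp' : (0 : ℝ) < p := by exact_mod_cast hp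
    have h2 : (p : ℝ) < arbBound ε p a m := by exact_mod_cast h1
    rw [arbBound, Nat.floor_pos]
    have h3 : 1 ≤ (arbBound ε p a m : ℝ) / p := (one_le_div hp').2 h2.le
    have h4 : 0 ≤ (2 + ε) * (arbBound ε p a m : ℝ) / p := by positivity
    linarith

/-- With `m + 1` iterations, the bound after `m` of them is still at least `1`, so `2 ^ m ≤ (p / 4)
^ m ≤ a`; the remaining `2` is absorbed by `2 * log a`. -/
theorem numIter_add_one_le {ε : ℝ} (hε : 0 < ε) (hε1 : ε < 1) {p a : ℕ} (hp : 16 ≤ p)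
    (ha : 2 ≤ a) : (numIter ε p a : ℝ) + 1 ≤ 3 * Real.logb 2 a := by
  have ha' : (2 : ℝ) ≤ a := by exact_mod_cast ha
  have hlog : 1 ≤ Real.logb 2 a := by
    rw [Real.le_logb_iff_rpow_le one_lt_two (by linarith)]; simpa using ha'
  rcases h : numIter ε p a with _ | m
  · simp; linarith
  · have h1 := lt_arbBound_of_lt_numIter (ε := ε) (p := p) (a := a) (i := m) (by omega)
    have hp' : (16 : ℝ) ≤ p := by exact_mod_cast hp
    have h2 : (1 : ℝ) ≤ arbBound ε p a m := by exact_mod_cast (by omega : 1 ≤ arbBound ε p a m)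
    have h3 : (2 : ℝ) ^ m ≤ a := by
      calc (2 : ℝ) ^ m ≤ ((p : ℝ) / 4) ^ m := by gcongr; linarith
        _ ≤ ((p : ℝ) / 4) ^ m * arbBound ε p a m := le_mul_of_one_le_right (by positivity) h2
        _ ≤ a := pow_mul_arbBound_le hε hε1 (by omega) a m
    have h4 : (m : ℝ) ≤ Real.logb 2 a := by
      rw [Real.le_logb_iff_rpow_le one_lt_two (by linarith), Real.rpow_natCast]
      exact h3
    push_cast
    linarith

theorem natLog_le_logb {n : ℕ} (hn : n ≠ 0) : (Nat.log 2 n : ℝ) ≤ Real.logb 2 n := by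
  rw [Real.le_logb_iff_rpow_le one_lt_two (by positivity), Real.rpow_natCast]
  exact_mod_cast Nat.pow_log_le_self 2 hn

theorem one_le_logb {n : ℕ} (hn : 2 ≤ n) : 1 ≤ Real.logb 2 n := by
  rw [Real.le_logb_iff_rpow_le one_lt_two (by positivity)]
  simpa using hn

/-- `m * (log n + 1)` sets suffice for the `H`-partition, if `2 ≤ (1 + ε / 2) ^ m`. -/
theorem lt_pow_mul_log {x : ℝ} {m : ℕ} (hx : 2 ≤ x ^ m) (n : ℕ) :
    (n : ℝ) < x ^ (m * (Nat.log 2 n + 1)) := by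
  rw [pow_mul]
  calc (n : ℝ) < 2 ^ (Nat.log 2 n + 1) := by
        exact_mod_cast Nat.lt_pow_succ_log_self one_lt_two n
    _ ≤ _ := by gcongr

/-- The power `Δ ^ (1 - η)` eventually exceeds `K`. -/
theorem exists_mul_rpow_lt_sq {K η : ℝ} (hK : 0 < K) (hη1 : η < 1) :
    ∃ Δ₀ : ℕ, 2 ≤ Δ₀ ∧ ∀ Δ : ℕ, Δ₀ ≤ Δ → ⌊K * (Δ : ℝ) ^ (1 + η)⌋₊ < Δ ^ 2 := by
  have h := (tendsto_rpow_atTop (sub_pos.2 hη1)).comp tendsto_natCast_atTop_atTop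
    |>.eventually_gt_atTop K
  obtain ⟨N, hN⟩ := Filter.eventually_atTop.1 h
  refine ⟨max N 2, le_max_right _ _, fun Δ hΔ => ?_⟩
  have h1 : K < (Δ : ℝ) ^ (1 - η) := hN Δ (le_trans (le_max_left _ _) hΔ)
  have hpos : (0 : ℝ) < Δ := by
    exact_mod_cast two_pos.trans_le (le_trans (le_max_right N 2) hΔ)
  rw [Nat.floor_lt (by positivity)]
  calc K * (Δ : ℝ) ^ (1 + η) < (Δ : ℝ) ^ (1 - η) * (Δ : ℝ) ^ (1 + η) := by gcongr
    _ = ((Δ ^ 2 : ℕ) : ℝ) := by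
      rw [← Real.rpow_add hpos]; push_cast; rw [← Real.rpow_natCast]; congr 1; push_cast; ring


/-- The program of the distributed algorithm, for networks with `n` vertices. -/
noncomputable def mainProg (ε : ℝ) (p m n a : ℕ) : List Step :=
  legalProg ε p a (m * (Nat.log 2 n + 1)) (Nat.log 2 n) (numIter ε p a)

theorem mul_log_add_one_le {C : ℝ} {m : ℕ} (hmC : 2 * (m : ℝ) ≤ C) {n : ℕ} (hn : 2 ≤ n) :
    ((m * (Nat.log 2 n + 1) : ℕ) : ℝ) ≤ C * Real.logb 2 n := by
  have h1 := natLog_le_logb (n := n) (by omega)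
  have h2 := one_le_logb hn
  push_cast
  calc (m : ℝ) * (Nat.log 2 n + 1) ≤ m * (Real.logb 2 n + Real.logb 2 n) := by gcongr
    _ = 2 * m * Real.logb 2 n := by ring
    _ ≤ _ := by gcongr

theorem length_mainProg_le {ε C : ℝ} (hε : 0 < ε) (hε1 : ε < 1) {p m : ℕ} (hp : 16 ≤ p)
    (hmC : 2 * (m : ℝ) ≤ C) {n a : ℕ} (hn : 2 ≤ n) (ha : 2 ≤ a) :
    ((mainProg ε p m n a).length : ℝ) ≤
      3 * (C * ((64 * p) ^ 2 + 1) + 3) * Real.logb 2 a * Real.logb 2 n := by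
  have h1 := natLog_le_logb (n := n) (by omega)
  have h2 := one_le_logb hn
  have h3 := numIter_add_one_le hε hε1 hp ha
  have h4 := mul_log_add_one_le hmC hn
  have h5 := one_le_logb ha
  calc ((mainProg ε p m n a).length : ℝ)
      ≤ ((numIter ε p a : ℝ) + 1) *
          (((m * (Nat.log 2 n + 1) : ℕ) : ℝ) * ((64 * p) ^ 2 + 1) + Nat.log 2 n + 2) := by
        exact_mod_cast length_legalProg_le ε p a (m * (Nat.log 2 n + 1)) (Nat.log 2 n)
          (numIter ε p a)
    _ ≤ (3 * Real.logb 2 a) * (C * Real.logb 2 n * ((64 * p) ^ 2 + 1) + Real.logb 2 n +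
          2 * Real.logb 2 n) := by
        gcongr
        linarith
    _ = _ := by ring

theorem mainProg_isLegalColoringExecution {V : Type*} [Fintype V] {ε C : ℝ} (hε : 0 < ε)
    (hε1 : ε < 1) {p b m : ℕ} (hp : 16 ≤ p) (hpb : p = 2 ^ b) (hC : 1024 ≤ C)
    (hm : 2 ≤ (1 + ε / 2) ^ m) (hmC : 2 * (m : ℝ) ≤ C) {G : SimpleGraph V} {ident : V → ℕ}
    (hi : IsIdentity ident) (hn : 2 ≤ Fintype.card V) {a : ℕ} (ha : 0 < a) (hG : IsSparse G a) :
    IsLegalColoringExecution ε C p a G ((algorithmOf (mainProg ε p m)).output G ident a) := by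
  have h := run_legalProg hε hε1 hC (lt_pow_mul_log hm (Fintype.card V))
    (mul_log_add_one_le hmC hn) hi hG hpb (fun _ => lt_arbBound_of_lt_numIter)
    (arbBound_numIter_le hε hε1 hp a) (arbBound_numIter_pos hε (by omega) ha)
  convert h using 1
  funext v
  exact algorithmOf_output _ G ident a v

theorem maxDegree_le_card {V : Type*} [Fintype V] (G : SimpleGraph V) [DecidableRel G.Adj] :
    G.maxDegree ≤ Fintype.card V :=
  G.maxDegree_le_of_forall_degree_le _ fun v => (G.degree_lt_card_verts v).le

end ArbColor

/-! ### The main theorem: choice of the constants -/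

theorem mainTheorem2 :
    ∃ c : ℕ, ∀ ε : ℝ, 0 < ε → ε < 1 → ∃ C : ℝ, ∀ η : ℝ, 0 < η → ∀ p : ℕ, p = 2 ^ (c * ⌈1 / η⌉₊) →
      ∃ K : ℝ, 0 < K ∧
        -- every execution of the procedure produces a legal coloring with `O(a ^ (1 + η))` colors
        (∀ (V : Type*) [Fintype V] (G : SimpleGraph V) (a : ℕ), 2 ≤ a → ArbColor.arboricity G ≤ a →
          ∀ L : V → ArbColor.VertexLog, ArbColor.IsLegalColoringExecution ε C p a G L →
            ArbColor.IsLegalColoring G ⌊K * (a : ℝ) ^ (1 + η)⌋₊ (fun v => (L v).color)) ∧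
        -- the procedure can be carried out distributively within `O(log a * log n)` rounds
        ∃ A : ArbColor.LocalAlgorithm ArbColor.VertexLog,
          (∀ n a : ℕ, 2 ≤ n → 2 ≤ a →
            (A.rounds n a : ℝ) ≤ K * Real.logb 2 a * Real.logb 2 n) ∧
          (∀ (V : Type*) [Fintype V] (G : SimpleGraph V) (ident : V → ℕ) (a : ℕ),
            ArbColor.IsIdentity ident → 2 ≤ Fintype.card V → 2 ≤ a → ArbColor.arboricity G ≤ a →
              ArbColor.IsLegalColoringExecution ε C p a G (A.output G ident a) ∧
              ArbColor.IsLegalColoring G ⌊K * (a : ℝ) ^ (1 + η)⌋₊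
                (fun v => (A.output G ident a v).color)) ∧
          -- the same with the maximum degree in place of `a`
          (∀ (V : Type*) [Fintype V] (G : SimpleGraph V) [DecidableRel G.Adj] (ident : V → ℕ),
            ArbColor.IsIdentity ident → 2 ≤ G.maxDegree →
              ArbColor.IsLegalColoringExecution ε C p G.maxDegree G
                (A.output G ident G.maxDegree) ∧
              ArbColor.IsLegalColoring G ⌊K * (G.maxDegree : ℝ) ^ (1 + η)⌋₊
                (fun v => (A.output G ident G.maxDegree v).color)) ∧
          -- fewer than `Δ ^ 2` colors in polylogarithmic time
          (η < 1 → ∃ Δ₀ : ℕ,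
            ∀ (V : Type*) [Fintype V] (G : SimpleGraph V) [DecidableRel G.Adj] (ident : V → ℕ),
              ArbColor.IsIdentity ident → Δ₀ ≤ G.maxDegree →
                (∃ M : ℕ, M < G.maxDegree ^ 2 ∧ ArbColor.IsLegalColoring G M
                  (fun v => (A.output G ident G.maxDegree v).color)) ∧
                (A.rounds (Fintype.card V) G.maxDegree : ℝ) ≤
                  K * Real.logb 2 (Fintype.card V) ^ 2) := by
  refine ⟨4, fun ε hε hε1 => ?_⟩
  obtain ⟨m, hm⟩ := pow_unbounded_of_one_lt (2 : ℝ) (by linarith : 1 < 1 + ε / 2)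
  -- The `1024` covers the `(32 t) ^ 2` defective colors; `2 m` covers the `m (⌊log n⌋ + 1)` levels,
  -- as `1 ≤ log n`.
  refine ⟨max 1024 (2 * m), fun η hη p hp => ?_⟩
  set C : ℝ := max 1024 (2 * m)
  have hC : 1024 ≤ C := le_max_left _ _
  have hmC : 2 * (m : ℝ) ≤ C := le_max_right _ _
  have h16 := ArbColor.sixteen_le_of_eq_two_pow hη hp
  -- The first summand bounds the rounds, the second the palette.
  set K : ℝ := 3 * (C * ((64 * p) ^ 2 + 1) + 3) + (p : ℝ) * (3 * p + 1)
  have hKp : (p : ℝ) * (3 * p + 1) ≤ K := le_add_of_nonneg_left (by positivity)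
  have hKr : 3 * (C * ((64 * p) ^ 2 + 1) + 3) ≤ K := le_add_of_nonneg_right (by positivity)
  have hK0 : 0 < K := by positivity
  have hrounds : ∀ n a : ℕ, 2 ≤ n → 2 ≤ a →
      ((ArbColor.mainProg ε p m n a).length : ℝ) ≤ K * Real.logb 2 a * Real.logb 2 n := by
    intro n a hn ha
    refine (ArbColor.length_mainProg_le hε hε1 h16 hmC hn ha).trans ?_
    have h1 := ArbColor.one_le_logb hn
    have h2 := ArbColor.one_le_logb ha
    gcongr
  refine ⟨K, hK0, fun V _ G a ha _ L hL => hL.isLegalColoring hε hε1 hη hp (by omega) hKp,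
    ArbColor.algorithmOf (ArbColor.mainProg ε p m), hrounds, ?_, ?_, ?_⟩
  · intro V _ G ident a hi hn ha hG
    have h := ArbColor.mainProg_isLegalColoringExecution hε hε1 h16 hp hC hm.le hmC hi hn
      (by omega) (ArbColor.isSparse_of_arboricity_le hG)
    exact ⟨h, h.isLegalColoring hε hε1 hη hp (by omega) hKp⟩
  · intro V _ G _ ident hi hΔ
    have hn : 2 ≤ Fintype.card V := by
      have := ArbColor.maxDegree_le_card G
      omega
    have h := ArbColor.mainProg_isLegalColoringExecution hε hε1 h16 hp hC hm.le hmC hi hn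
      (by omega) (ArbColor.isSparse_maxDegree G)
    exact ⟨h, h.isLegalColoring hε hε1 hη hp (by omega) hKp⟩
  · intro hη1
    obtain ⟨Δ₀, hΔ₀, hcol⟩ := ArbColor.exists_mul_rpow_lt_sq hK0 hη1
    refine ⟨Δ₀, fun V _ G _ ident hi hΔ => ?_⟩
    have hle := ArbColor.maxDegree_le_card G
    have hn : 2 ≤ Fintype.card V := by omega
    have h := ArbColor.mainProg_isLegalColoringExecution hε hε1 h16 hp hC hm.le hmC hi hn
      (by omega) (ArbColor.isSparse_maxDegree G)
    refine ⟨⟨_, hcol _ hΔ, h.isLegalColoring hε hε1 hη hp (by omega) hKp⟩, ?_⟩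
    refine (hrounds _ _ hn (by omega)).trans ?_
    have h1 := ArbColor.one_le_logb hn
    have h2 : Real.logb 2 G.maxDegree ≤ Real.logb 2 (Fintype.card V) :=
      Real.logb_le_logb_of_le one_lt_two (by exact_mod_cast (by omega : 0 < G.maxDegree))
        (by exact_mod_cast hle)
    rw [pow_two, ← mul_assoc]
    gcongr
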